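/- Notation. For a group $G$, let $\mathbb{Z}BG_*$ be the Moore complex of the simplicial classifying space $BG$: $\mathbb{Z}BG_m$ is the free abelian group on the $m$-simplices $[g_1,\dots,g_m]$ ($g_i\in G$; degenerate ones included), and $\partial=\sum_{i=0}^{m}(-1)^i d_i$, where $d_0$ drops $g_1$, $d_m$ drops $g_m$, and $d_i$ replaces $g_i,g_{i+1}$ by $g_ig_{i+1}$ for $1\le i\le m-1$. A group homomorphism $f\colon G\to H$ induces the chain map $[g_1,\dots,g_m]\mapsto[f(g_1),\dots,f(g_m)]$, also denoted $f$; let $e$ denote the trivial homomorphism. Write $a^b=bab^{-1}$. Put $\mathcal{A}^0(G)=G$ and $$\mathcal{A}^{n+1}(G)=\langle \mathcal{A}^n(G),u_{n+1},t_{n+1}\mid a^{t_{n+1}}=a\cdot a^{u_{n+1}},\ [a^{u_{n+1}},b]=1\ \text{ for all } a,b\in\mathcal{A}^n(G)\rangle ,$$ and let the mitosis embedding $i_G^n\colon G\to\mathcal{A}^n(G)$ be the composite of the canonical homomorphisms $\mathcal{A}^{k}(G)\to\mathcal{A}^{k+1}(G)$, $0\le k<n$ (so $i_G^0=\mathrm{id}$).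 A partial simplicial chain homotopy of dimension $n$ between $i_G^n$ and $e$ consists of homomorphisms $\Psi_k\colon\mathbb{Z}BG_k\to\mathbb{Z}B\mathcal{A}^n(G)_{k+1}$ for $0\le k\le n$ only, with $\partial\Psi_k+\Psi_{k-1}\partial=i_G^n-e$ on $\mathbb{Z}BG_k$ for all $0\le k\le n$ (where $\Psi_{-1}\partial=0$). The diameter of a chain $\sum_\alpha n_\alpha e_\alpha$ in the simplex basis is $\sum_\alpha|n_\alpha|$. A family of such homotopies of dimension $n$ is uniformly controlled by $\gamma\colon\mathbb{N}\cup\{0\}\to\mathbb{N}\cup\{0\}$ if for every member $\Psi$ and every $k\le n$, the maximum of the diameters of $\Psi_i(\sigma)$, over all simplices $\sigma$ of dimension $i\le k$, is at most $\gamma(k)$. Theorem. There is a function $\gamma\colon\mathbb{N}\cup\{0\}\to\mathbb{N}\cup\{0\}$, independent of $n$ and $G$, with $\gamma(0)=0$ and $$\gamma(m)=2^m(m+1)+\sum_{k=1}^{m-1}\gamma(k)\binom{m+1}{m-k}\qquad(m\ge1),$$ so that $\gamma(0),\dots,\gamma(7)$ are $0,\,4,\,24,\,152,\,1120,\,9732,\,98336,\,1135024$,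 such that for each $n\ge0$ there is a family $$\{\Psi_G^n : e\simeq i_G^n \mid G \text{ is a group}\}$$ of partial simplicial chain homotopies $\Psi_G^n$ of dimension $n$ between the chain maps $i_G^n,\,e\colon\mathbb{Z}BG_*\to\mathbb{Z}B\mathcal{A}^n(G)_*$ which is uniformly controlled by $\gamma$. -/

import Mathlib

universe u

noncomputable section

/-! ### Based chain complexes, chain maps, diameters -/

/-- A positive based chain complex over `ℤ`: in each degree `n` the free abelian group
`cell n →₀ ℤ` on a given basis `cell n`, with boundary operators squaring to zero. -/
structure BasedChainComplex where
  /-- the basis in degree `n` -/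
  cell : ℕ → Type u
  /-- the boundary operator from degree `n + 1` to degree `n` -/
  d : ∀ n : ℕ, (cell (n + 1) →₀ ℤ) →ₗ[ℤ] (cell n →₀ ℤ)
  d_comp_d : ∀ n : ℕ, (d n).comp (d (n + 1)) = 0

namespace BasedChainComplex

/-- The group of `n`-chains. -/
abbrev Chain (C : BasedChainComplex.{u}) (n : ℕ) : Type u := C.cell n →₀ ℤ

/-- Chain maps between based chain complexes (not required to respect the bases). -/
structure Map (C D : BasedChainComplex.{u}) where
  hom : ∀ n : ℕ, C.Chain n →ₗ[ℤ] D.Chain n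
  comm : ∀ n : ℕ, (D.d n).comp (hom (n + 1)) = (hom n).comp (C.d n)

/-- A partial chain homotopy of dimension `n` between `f` and `g`: homomorphisms
`P i : C i → D (i + 1)`, defined for `i ≤ n` only, with `∂ P + P ∂ = f - g` in all
degrees `≤ n` (where `∂ = 0` on chains of degree `0`). -/
structure PartialHomotopy {C D : BasedChainComplex.{u}} (f g : Map C D) (n : ℕ) where
  hom : ∀ i : ℕ, i ≤ n → (C.Chain i →ₗ[ℤ] D.Chain (i + 1))
  comm_zero : (D.d 0).comp (hom 0 (Nat.zero_le n)) = f.hom 0 - g.hom 0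
  comm_succ : ∀ (i : ℕ) (hi : i + 1 ≤ n),
    (D.d (i + 1)).comp (hom (i + 1) hi) + (hom i (Nat.le_of_succ_le hi)).comp (C.d i)
      = f.hom (i + 1) - g.hom (i + 1)

/-- The diameter of a chain `∑ n_α e_α`, namely `∑ |n_α|`. -/
def diameter {ι : Type u} (c : ι →₀ ℤ) : ℕ := c.sum fun _ a => a.natAbs

/-- The diameter function of a partial chain homotopy of dimension `n`, defined for `k ≤ n`:
the supremum (possibly infinite) of the diameters of `P e`, over all basis elements `e` of
degree at most `k`. -/
def PartialHomotopy.diameterFun {C D : BasedChainComplex.{u}} {f g : Map C D} {n : ℕ}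
    (P : PartialHomotopy f g n) (k : ℕ) (hk : k ≤ n) : ℕ∞ :=
  ⨆ (i : ℕ) (hi : i ≤ k) (e : C.cell i),
    (diameter (P.hom i (hi.trans hk) (Finsupp.single e 1)) : ℕ∞)

/-- `δ` controls the partial chain homotopy `P`. -/
def PartialHomotopy.ControlledBy {C D : BasedChainComplex.{u}} {f g : Map C D} {n : ℕ}
    (P : PartialHomotopy f g n) (δ : ℕ → ℕ) : Prop :=
  ∀ (k : ℕ) (hk : k ≤ n), P.diameterFun k hk ≤ (δ k : ℕ∞)

/-- A family of partial chain homotopies is uniformly controlled by `δ` if every member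
is controlled by the same `δ`. -/
def UniformlyControlledBy {I : Type*} {C D : I → BasedChainComplex.{u}}
    {f g : ∀ a : I, Map (C a) (D a)} {n : ℕ}
    (P : ∀ a : I, PartialHomotopy (f a) (g a) n) (δ : ℕ → ℕ) : Prop :=
  ∀ a : I, (P a).ControlledBy δ

end BasedChainComplex

/-! ### The Moore complex of the simplicial classifying space -/

namespace Bar

/-- The `i`-th face `d_i : BG_{n+1} → BG_n`, where `BG_n` is the set of `n`-tuples
`[g_1, …, g_n]` (`g_j` is the entry with index `j - 1`): it drops `g_1` for `i = 0`, drops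
`g_{n+1}` for `i = n + 1`, and otherwise replaces `g_i, g_{i+1}` by `g_i * g_{i+1}`. -/
def face {G : Type u} [Group G] {n : ℕ} (i : Fin (n + 2)) (g : Fin (n + 1) → G) : Fin n → G :=
  fun j =>
    if (j : ℕ) + 1 < i then g j.castSucc
    else if (j : ℕ) + 1 = i then g j.castSucc * g j.succ
    else g j.succ

theorem face_face {G : Type u} [Group G] {n : ℕ} (i : Fin (n + 2)) (j : Fin (n + 3))
    (h : (j : ℕ) ≤ i) (g : Fin (n + 2) → G) :
    face i (face j g) = face (Fin.castLT j (lt_of_le_of_lt h i.is_lt)) (face i.succ g) := by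
  funext k
  simp only [face, Fin.val_castSucc, Fin.val_succ, Fin.val_castLT, Fin.succ_castSucc]
  split_ifs <;> first | rfl | (exfalso; omega) | simp only [mul_assoc]

/-- The boundary operator `∂ = ∑ (-1)^i d_i`. -/
def boundary (G : Type u) [Group G] (n : ℕ) :
    ((Fin (n + 1) → G) →₀ ℤ) →ₗ[ℤ] ((Fin n → G) →₀ ℤ) :=
  ∑ i : Fin (n + 2), (-1 : ℤ) ^ (i : ℕ) • Finsupp.lmapDomain ℤ ℤ (face i)

theorem boundary_comp_boundary (G : Type u) [Group G] (n : ℕ) :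
    (boundary G n).comp (boundary G (n + 1)) = 0 := by
  have hexp : (boundary G n).comp (boundary G (n + 1)) =
      ∑ ij : Fin (n + 2) × Fin (n + 3),
        ((-1 : ℤ) ^ (ij.1 : ℕ) • Finsupp.lmapDomain ℤ ℤ (face (G := G) ij.1)).comp
          ((-1 : ℤ) ^ (ij.2 : ℕ) • Finsupp.lmapDomain ℤ ℤ (face (G := G) ij.2)) := by
    rw [Fintype.sum_prod_type]
    apply LinearMap.ext
    intro x
    simp only [boundary, LinearMap.comp_apply, LinearMap.sum_apply, map_sum]
    rw [Finset.sum_comm]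
  rw [hexp]
  let P := Fin (n + 2) × Fin (n + 3)
  let S : Finset P := {ij : P | (ij.2 : ℕ) ≤ (ij.1 : ℕ)}
  rw [← Finset.sum_add_sum_compl S, ← eq_neg_iff_add_eq_zero,
    ← Finset.sum_neg_distrib]
  let φ : ∀ ij : P, ij ∈ S → P := fun ij hij =>
    (Fin.castLT ij.2 (lt_of_le_of_lt (Finset.mem_filter.mp hij).right (Fin.is_lt ij.1)), ij.1.succ)
  apply Finset.sum_bij φ
  · intro ij hij
    simp_rw [S, φ, Finset.compl_filter, Finset.mem_filter_univ, Fin.val_succ,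
      Fin.val_castLT] at hij ⊢
    omega
  · rintro ⟨i, j⟩ hij ⟨i', j'⟩ hij' h
    have h1 := congrArg (fun p : P => (p.1 : ℕ)) h
    have h2 := congrArg (fun p : P => (p.2 : ℕ)) h
    simp only [φ, Fin.val_castLT, Fin.val_succ] at h1 h2
    exact Prod.ext (Fin.ext (by simpa using h2)) (Fin.ext (by simpa using h1))
  · rintro ⟨i', j'⟩ hij'
    simp_rw [S, Finset.compl_filter, Finset.mem_filter_univ, not_le] at hij'
    refine ⟨(j'.pred ?_, Fin.castSucc i'), ?_, ?_⟩
    · rintro rfl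
      simp only [Fin.val_zero, not_lt_zero] at hij'
    · simp only [S, Finset.mem_filter_univ, Fin.val_castSucc, Fin.val_pred]
      omega
    · simp only [φ, Fin.castLT_castSucc, Fin.succ_pred]
  · rintro ⟨i, j⟩ hij
    have h : (j : ℕ) ≤ i := by simpa [S] using hij
    simp only [LinearMap.smul_comp, LinearMap.comp_smul, smul_smul, ← neg_smul,
      ← Finsupp.lmapDomain_comp]
    congr 1
    · simp only [φ, Fin.val_succ, Fin.val_castLT, pow_add, pow_one]
      ring
    · congr 1
      funext g
      exact face_face i j h g

/-- The Moore complex `ℤ BG_*` of the simplicial classifying space `BG`, based by the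
simplices `[g_1, …, g_n]` of `BG`, degenerate ones included. -/
def moore (G : Type u) [Group G] : BasedChainComplex.{u} where
  cell n := Fin n → G
  d := boundary G
  d_comp_d := boundary_comp_boundary G

theorem face_comp_hom {G H : Type u} [Group G] [Group H] (f : G →* H) {n : ℕ} (i : Fin (n + 2))
    (g : Fin (n + 1) → G) : face i (f ∘ g) = f ∘ face i g := by
  funext k
  simp only [face, Function.comp_apply]
  split_ifs <;> simp

theorem boundary_comp_hom {G H : Type u} [Group G] [Group H] (f : G →* H) (n : ℕ) :
    (boundary H n).comp
        (Finsupp.lmapDomain ℤ ℤ (fun g : Fin (n + 1) → G => (f ∘ g : Fin (n + 1) → H))) =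
      (Finsupp.lmapDomain ℤ ℤ (fun g : Fin n → G => (f ∘ g : Fin n → H))).comp
        (boundary G n) := by
  apply LinearMap.ext
  intro x
  simp only [boundary, LinearMap.comp_apply, LinearMap.sum_apply, map_sum,
    LinearMap.smul_apply, map_smul, Finsupp.lmapDomain_apply, ← Finsupp.mapDomain_comp]
  refine Finset.sum_congr rfl fun i _ => ?_
  congr 2
  funext g
  exact face_comp_hom f i g

/-- The chain map `ℤ BG_* → ℤ BH_*` induced by a group homomorphism `f`, that is,
`[g_1, …, g_n] ↦ [f g_1, …, f g_n]`. -/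
def map {G H : Type u} [Group G] [Group H] (f : G →* H) :
    BasedChainComplex.Map (moore G) (moore H) where
  hom n := Finsupp.lmapDomain ℤ ℤ (fun g : Fin n → G => (f ∘ g : Fin n → H))
  comm := boundary_comp_hom f

end Bar

/-! ### Mitosis -/

open Monoid.Coprod in
/-- The relators of the mitosis of `G`, in the free product of `G` with the free group on two
letters `u` (`false`) and `t` (`true`): with `a ^ b = b a b⁻¹`, they express the relations
`a ^ t = a * a ^ u` and `[a ^ u, b] = 1` for all `a, b ∈ G`. -/
def Mitosis.relators (G : Type u) [Group G] : Set (Monoid.Coprod G (FreeGroup Bool)) :=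
  let u : Monoid.Coprod G (FreeGroup Bool) := inr (FreeGroup.of false)
  let t : Monoid.Coprod G (FreeGroup Bool) := inr (FreeGroup.of true)
  {r | ∃ a : G, r = (t * inl a * t⁻¹) * (inl a * (u * inl a * u⁻¹))⁻¹} ∪
  {r | ∃ a b : G, r = (u * inl a * u⁻¹) * inl b * (u * inl a * u⁻¹)⁻¹ * (inl b)⁻¹}

/-- The mitosis `𝒜(G) = ⟨G, u, t | a ^ t = a * a ^ u, [a ^ u, b], a, b ∈ G⟩`. -/
abbrev Mitosis (G : Type u) [Group G] : Type u :=
  Monoid.Coprod G (FreeGroup Bool) ⧸ Subgroup.normalClosure (Mitosis.relators G)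

/-- The canonical homomorphism `k_G : G → 𝒜(G)`. -/
def Mitosis.incl (G : Type u) [Group G] : G →* Mitosis G :=
  (QuotientGroup.mk' (Subgroup.normalClosure (Mitosis.relators G))).comp Monoid.Coprod.inl

/-- The `n`-th mitosis `𝒜^n(G)`, with `𝒜^0(G) = G` and `𝒜^{n+1}(G) = 𝒜(𝒜^n(G))`. -/
def Mitosis.iter (G : GrpCat.{u}) : ℕ → GrpCat.{u}
  | 0 => G
  | n + 1 => GrpCat.of (Mitosis (Mitosis.iter G n))

/-- The `n`-th mitosis embedding `i_G^n : G → 𝒜^n(G)`, the composite of the homomorphisms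
`k_G, k_{𝒜(G)}, …, k_{𝒜^{n-1}(G)}`. -/
def Mitosis.embedding (G : GrpCat.{u}) : ∀ n : ℕ, G →* Mitosis.iter G n
  | 0 => MonoidHom.id G
  | n + 1 => (Mitosis.incl (Mitosis.iter G n)).comp (Mitosis.embedding G n)

end

/-! Modulo left translation, the ordered simplices (x₀, …, xₘ) with vertices in a group are the bar
simplices [x₀⁻¹x₁, …], so the work takes place with chains of vertex lists, where cones, prisms and
shuffles have simple recursions. The complex is augmented: the empty list has degree -1. `normalize`
fixes one representative of each translation class, and identities are only needed after it;
`toTuple` and `ofTuple` transfer the result to the Moore complex.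

The theorem is an induction on n by a cancellation. Let α, β : K → A commute elementwise, and let s
conjugate β to the product αβ. In positive degrees αβ is homotopic to β by a prism (`bd_prism`). The
chain map of αβ is also homotopic to its subdivision by the Alexander–Whitney diagonal followed by
shuffles (`bd_ez`). Modulo translation that subdivision is α + β plus products of α on a front face
with β on a back face, both of positive degree (`normalize_subdivision`). If k : G → K has a null
homotopy Θ up to degree n, then along k these cross terms are bounded by shuffling Θ(front) with
k(back) (`normalize_bd_crossTerm`). This works up to degree n + 1, since a back face of positive
degree leaves a front face of degree at most n. Cancelling β leaves a null homotopy of α ∘ k up to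
degree n + 1 (`IsNullHomotopy.step`). In the mitosis, α is the inclusion, β is x ↦ u⁻¹xu and s =
u⁻¹tu (`conj_conjIncl`).

In degree m ≥ 1 the prism has m + 1 simplices, the subdivision homotopy at most 2^(m+1) - 2 - m, and
the cross terms at most the sum in the recursion for γ. The total is at most γ(m) - 1. The remaining
unit pays for contracting e in positive degrees, which takes one degenerate simplex in each odd
degree (`trivialHomotopy_comm`). -/

noncomputable section

namespace ListChain

/-! ### Augmented ordered chains on lists of vertices -/

/-- Chains of vertex lists; a list with `n + 1` entries is an ordered `n`-simplex. -/
abbrev LChain (V : Type*) := List V →₀ ℤ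

variable {V W X Y Z N : Type*} [AddCommGroup N]

/-- The basis chain of a list. -/
def cell (l : List V) : LChain V := Finsupp.single l 1

/-- The linear extension of a function on lists. -/
def lext (f : List V → N) : LChain V →ₗ[ℤ] N := Finsupp.linearCombination ℤ f

@[simp] theorem lext_cell (f : List V → N) (l : List V) : lext f (cell l) = f l := by
  simp [lext, cell]

theorem hom_ext {f g : LChain V →ₗ[ℤ] N} (h : ∀ l, f (cell l) = g (cell l)) : f = g :=
  Finsupp.lhom_ext' fun l => LinearMap.ext_ring (h l)

theorem apply_ext {f g : LChain V →ₗ[ℤ] N} (h : ∀ l, f (cell l) = g (cell l)) (z : LChain V) :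
    f z = g z := by rw [hom_ext h]

/-- Prepending a vertex. -/
def pre (x : V) : LChain V →ₗ[ℤ] LChain V := lext fun l => cell (x :: l)

@[simp] theorem pre_cell (x : V) (l : List V) : pre x (cell l) = cell (x :: l) := by simp [pre]

/-- The coefficient of the empty list. -/
def emptyCoeff : LChain V →ₗ[ℤ] ℤ := lext fun l => if l.isEmpty then 1 else 0

@[simp] theorem emptyCoeff_nil : emptyCoeff (cell ([] : List V)) = 1 := by simp [emptyCoeff]

@[simp] theorem emptyCoeff_cons (x : V) (l : List V) : emptyCoeff (cell (x :: l)) = 0 := by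
  simp [emptyCoeff]

@[simp] theorem emptyCoeff_pre (x : V) (z : LChain V) : emptyCoeff (pre x z) = 0 :=
  apply_ext (f := emptyCoeff ∘ₗ pre x) (g := 0) (by simp) z

/-- The boundary of a list of vertices, in the augmented ordered chain complex. -/
def bdList : List V → LChain V
  | [] => 0
  | x :: l => cell l - pre x (bdList l)

/-- The boundary operator of the augmented ordered chain complex. -/
def bd : LChain V →ₗ[ℤ] LChain V := lext bdList

@[simp] theorem bd_nil : bd (cell ([] : List V)) = 0 := by simp [bd, bdList]

@[simp] theorem bd_cons (x : V) (l : List V) : bd (cell (x :: l)) = cell l - pre x (bd (cell l)) := by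
  simp [bd, bdList]

@[simp] theorem bd_pre (x : V) (z : LChain V) : bd (pre x z) = z - pre x (bd z) :=
  apply_ext (f := bd ∘ₗ pre x) (g := LinearMap.id - pre x ∘ₗ bd) (by simp) z

/-- The map induced by a function on vertices. -/
def push (f : V → W) : LChain V →ₗ[ℤ] LChain W := lext fun l => cell (l.map f)

@[simp] theorem push_cell (f : V → W) (l : List V) : push f (cell l) = cell (l.map f) := by
  simp [push]

@[simp] theorem push_pre (f : V → W) (x : V) (z : LChain V) :
    push f (pre x z) = pre (f x) (push f z) :=
  apply_ext (f := push f ∘ₗ pre x) (g := pre (f x) ∘ₗ push f) (by simp) z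

theorem push_push (f : V → W) (g : W → X) (z : LChain V) :
    push g (push f z) = push (fun x => g (f x)) z :=
  apply_ext (f := push g ∘ₗ push f) (g := push fun x => g (f x)) (by simp [Function.comp_def]) z

@[simp] theorem emptyCoeff_push (f : V → W) (z : LChain V) :
    emptyCoeff (push f z) = emptyCoeff z :=
  apply_ext (f := emptyCoeff ∘ₗ push f) (g := emptyCoeff) (by rintro (_ | _) <;> simp) z

theorem push_bd (f : V → W) (z : LChain V) : push f (bd z) = bd (push f z) := by
  refine apply_ext (f := push f ∘ₗ bd) (g := bd ∘ₗ push f) (fun l => ?_) z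
  induction l with
  | nil => simp
  | cons x l ih => simp_all

/-- The sign involution given by the parity of the length. -/
def sgn : LChain V →ₗ[ℤ] LChain V := lext fun l => (-1 : ℤ) ^ l.length • cell l

theorem sgn_cell (l : List V) : sgn (cell l) = (-1 : ℤ) ^ l.length • cell l := by simp [sgn]

@[simp] theorem sgn_pre (x : V) (z : LChain V) : sgn (pre x z) = - pre x (sgn z) :=
  apply_ext (f := sgn ∘ₗ pre x) (g := - (pre x ∘ₗ sgn))
    (fun l => by simp [sgn_cell, pow_succ]) z

@[simp] theorem sgn_cons (x : V) (l : List V) : sgn (cell (x :: l)) = - pre x (sgn (cell l)) := by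
  rw [← pre_cell, sgn_pre]

@[simp] theorem sgn_nil : sgn (cell ([] : List V)) = cell [] := by simp [sgn_cell]

theorem sgn_bd (z : LChain V) : sgn (bd z) = - bd (sgn z) := by
  refine apply_ext (f := sgn ∘ₗ bd) (g := - (bd ∘ₗ sgn)) (fun l => ?_) z
  induction l with
  | nil => simp
  | cons x l ih =>
    simp only [LinearMap.comp_apply, LinearMap.neg_apply] at ih ⊢
    simp [ih]

/-! ### Bounded chains of pure length -/

/-- `Bdd n K c`: the chain `c` is a sum of at most `K` signed lists of length `n`. -/
inductive Bdd (n : ℕ) : ℕ → LChain V → Prop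
  | cell {l : List V} (h : l.length = n) : Bdd n 1 (cell l)
  | zero (K : ℕ) : Bdd n K 0
  | add {K K' : ℕ} {c c' : LChain V} : Bdd n K c → Bdd n K' c' → Bdd n (K + K') (c + c')
  | neg {K : ℕ} {c : LChain V} : Bdd n K c → Bdd n K (-c)
  | mono {K K' : ℕ} {c : LChain V} : K ≤ K' → Bdd n K c → Bdd n K' c

theorem Bdd.map {n n' K K' : ℕ} {c : LChain V} (h : Bdd n K c) (F : LChain V →ₗ[ℤ] LChain W)
    (hF : ∀ l : List V, l.length = n → Bdd n' K' (F (ListChain.cell l))) :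
    Bdd n' (K * K') (F c) := by
  induction h with
  | cell h => simpa using hF _ h
  | zero K => simpa using Bdd.zero _
  | add _ _ h1 h2 => rw [map_add, add_mul]; exact h1.add h2
  | neg _ h => rw [map_neg]; exact h.neg
  | mono hK _ h => exact h.mono (Nat.mul_le_mul_right _ hK)

theorem Bdd.eqOn {n K : ℕ} {c : LChain V} (h : Bdd n K c) {F F' : LChain V →ₗ[ℤ] N}
    (hF : ∀ l : List V, l.length = n → F (ListChain.cell l) = F' (ListChain.cell l)) :
    F c = F' c := by
  induction h with
  | cell h => exact hF _ h
  | zero K => simp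
  | add _ _ h1 h2 => rw [map_add, map_add, h1, h2]
  | neg _ h => rw [map_neg, map_neg, h]
  | mono hK _ h => exact h

/-- This is how `γ 0 = 0` forces a null homotopy to vanish on single vertices and on the empty list.
-/
theorem Bdd.eq_zero {n : ℕ} {c : LChain V} (h : Bdd n 0 c) : c = 0 := by
  have key : ∀ K, ∀ c : LChain V, Bdd n K c → K = 0 → c = 0 := by
    intro K c h
    induction h with
    | cell h => simp
    | zero K => simp
    | add _ _ h1 h2 => intro h; rw [h1 (by omega), h2 (by omega), add_zero]
    | neg _ h => intro h'; rw [h h', neg_zero]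
    | mono hK _ h => intro h'; exact h (by omega)
  exact key 0 c h rfl

theorem Bdd.pre {n K : ℕ} {c : LChain V} (h : Bdd n K c) (x : V) :
    Bdd (n + 1) K (ListChain.pre x c) := by
  simpa using h.map (ListChain.pre x) (n' := n + 1) (K' := 1) fun l hl => by
    rw [pre_cell]; exact .cell (by simp [hl])

theorem Bdd.push {n K : ℕ} {c : LChain V} (h : Bdd n K c) (f : V → W) :
    Bdd n K (ListChain.push f c) := by
  simpa using h.map (ListChain.push f) (n' := n) (K' := 1) fun l hl => by
    rw [push_cell]; exact .cell (by simp [hl])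

theorem Bdd.smul_sign {n K : ℕ} {c : LChain V} (h : Bdd n K c) (m : ℕ) :
    Bdd n K ((-1 : ℤ) ^ m • c) := by
  rcases neg_one_pow_eq_or ℤ m with hm | hm <;> rw [hm]
  · simpa using h
  · simpa using h.neg

theorem Bdd.sum {ι : Type*} (s : Finset ι) {n : ℕ} {K : ι → ℕ} {c : ι → LChain V}
    (h : ∀ i ∈ s, Bdd n (K i) (c i)) : Bdd n (∑ i ∈ s, K i) (∑ i ∈ s, c i) := by
  classical
  induction s using Finset.induction_on with
  | empty => simpa using Bdd.zero 0
  | insert a s ha ih =>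
    rw [Finset.sum_insert ha, Finset.sum_insert ha]
    exact (h a (by simp)).add (ih fun i hi => h i (by simp [hi]))

/-! ### Shuffle products -/

/-- The shuffle product of two lists: the signed sum of all lattice paths through the grid
of the vertices `v x y`. -/
def shuffleList (v : X → Y → Z) : List X → List Y → LChain Z
  | [], _ => 0
  | _ :: _, [] => 0
  | x :: xs, y :: ys => pre (v x y)
      ((emptyCoeff (cell xs) * emptyCoeff (cell ys)) • cell [] + shuffleList v xs (y :: ys) +
        (-1 : ℤ) ^ xs.length • shuffleList v (x :: xs) ys)
termination_by xs ys => xs.length + ys.length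

/-- The bilinear shuffle product. -/
def shuffle (v : X → Y → Z) : LChain X →ₗ[ℤ] LChain Y →ₗ[ℤ] LChain Z :=
  lext fun xs => lext fun ys => shuffleList v xs ys

@[simp] theorem shuffle_nil_left (v : X → Y → Z) (z : LChain Y) : shuffle v (cell []) z = 0 :=
  apply_ext (g := 0) (by simp [shuffle, shuffleList]) z

@[simp] theorem shuffle_nil_right (v : X → Y → Z) (z : LChain X) : shuffle v z (cell []) = 0 :=
  apply_ext (f := (shuffle v).flip (cell [])) (g := 0)
    (by rintro (_ | _) <;> simp [shuffle, shuffleList]) z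

theorem shuffle_cons_cons (v : X → Y → Z) (x : X) (y : Y) (xs : List X) (ys : List Y) :
    shuffle v (cell (x :: xs)) (cell (y :: ys)) = pre (v x y)
      ((emptyCoeff (cell xs) * emptyCoeff (cell ys)) • cell [] +
        shuffle v (cell xs) (cell (y :: ys)) +
        (-1 : ℤ) ^ xs.length • shuffle v (cell (x :: xs)) (cell ys)) := by
  simp [shuffle, shuffleList]

theorem bilin_ext {f g : LChain X →ₗ[ℤ] LChain Y →ₗ[ℤ] N}
    (h : ∀ l l', f (cell l) (cell l') = g (cell l) (cell l')) (z : LChain X) (z' : LChain Y) :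
    f z z' = g z z' := by
  rw [hom_ext fun l => hom_ext (h l)]

theorem shuffle_pre_pre (v : X → Y → Z) (x : X) (y : Y) (z : LChain X) (z' : LChain Y) :
    shuffle v (pre x z) (pre y z') = pre (v x y)
      ((emptyCoeff z * emptyCoeff z') • cell [] + shuffle v z (pre y z') +
        shuffle v (pre x (sgn z)) z') := by
  refine bilin_ext (f := (shuffle v).compl₁₂ (pre x) (pre y))
    (g := (((LinearMap.mul ℤ ℤ).compl₁₂ emptyCoeff emptyCoeff).compr₂
        (LinearMap.toSpanSingleton ℤ _ (cell [])) +
      (shuffle v).compl₁₂ LinearMap.id (pre y) +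
      (shuffle v).compl₁₂ (pre x ∘ₗ sgn) LinearMap.id).compr₂ (pre (v x y)))
    (fun l l' => ?_) z z'
  simp [shuffle_cons_cons, sgn_cell]

theorem shuffle_singleton_left (v : X → Y → Z) (x : X) (z : LChain Y) :
    shuffle v (cell [x]) z = push (v x) z - emptyCoeff z • cell [] := by
  refine apply_ext (g := push (v x) - (LinearMap.toSpanSingleton ℤ _ (cell [])) ∘ₗ emptyCoeff)
    (fun l => ?_) z
  induction l with
  | nil => simp
  | cons y l ih => simp_all [shuffle_cons_cons]

theorem shuffle_singleton_right (v : X → Y → Z) (y : Y) (z : LChain X) :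
    shuffle v z (cell [y]) = push (fun x => v x y) z - emptyCoeff z • cell [] := by
  refine apply_ext (f := (shuffle v).flip (cell [y]))
    (g := push (fun x => v x y) - (LinearMap.toSpanSingleton ℤ _ (cell [])) ∘ₗ emptyCoeff)
    (fun l => ?_) z
  induction l with
  | nil => simp
  | cons x l ih => simp_all [shuffle_cons_cons]

/-- The Leibniz rule; `sgn` counts vertices, not dimension, hence the minus sign. The last term is
the augmentation of a product of two vertices, which the other terms miss because shuffling with the
empty list gives zero. -/
theorem bd_shuffle_cell (v : X → Y → Z) (xs : List X) (ys : List Y) :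
    bd (shuffle v (cell xs) (cell ys)) = shuffle v (bd (cell xs)) (cell ys) -
      shuffle v (sgn (cell xs)) (bd (cell ys)) +
      (emptyCoeff (bd (cell xs)) * emptyCoeff (bd (cell ys))) • cell [] := by
  match xs, ys with
  | [], ys => simp
  | x :: xs, [] => simp
  | x :: xs, y :: ys =>
    have ih1 := bd_shuffle_cell v xs (y :: ys)
    have ih2 := bd_shuffle_cell v (x :: xs) ys
    have hs := sgn_cell xs
    have hss : ((-1 : ℤ) ^ xs.length) * ((-1 : ℤ) ^ xs.length) = 1 := by
      rw [← mul_pow]; simp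
    simp only [← pre_cell] at ih1 ih2 ⊢
    generalize (-1 : ℤ) ^ xs.length = s at *
    generalize cell xs = a at *
    generalize cell ys = b at *
    have hb : sgn (bd a) = - s • bd a := by rw [sgn_bd, hs]; simp
    rw [shuffle_pre_pre, bd_pre]
    simp only [map_add, map_smul, map_sub, ih1, ih2, bd_nil, bd_pre, LinearMap.sub_apply, sgn_pre,
      hs, map_neg, LinearMap.neg_apply, LinearMap.smul_apply, emptyCoeff_pre, shuffle_pre_pre, hb]
    -- With the sign specialised to ±1 the identity becomes purely additive.
    rcases Int.isUnit_iff.1 (IsUnit.of_mul_eq_one s hss) with rfl | rfl <;>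
    simp <;> abel
termination_by xs.length + ys.length

theorem bd_shuffle (v : X → Y → Z) (z : LChain X) (z' : LChain Y) :
    bd (shuffle v z z') = shuffle v (bd z) z' - shuffle v (sgn z) (bd z') +
      (emptyCoeff (bd z) * emptyCoeff (bd z')) • cell [] := by
  refine bilin_ext (f := (shuffle v).compr₂ bd)
    (g := (shuffle v).compl₁₂ bd LinearMap.id - (shuffle v).compl₁₂ sgn bd +
      ((LinearMap.mul ℤ ℤ).compl₁₂ (emptyCoeff ∘ₗ bd) (emptyCoeff ∘ₗ bd)).compr₂
        (LinearMap.toSpanSingleton ℤ _ (cell [])))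
    (fun l l' => ?_) z z'
  simpa using bd_shuffle_cell v l l'

theorem push_shuffle (v : X → Y → Z) (f : Z → V) (z : LChain X) (z' : LChain Y) :
    push f (shuffle v z z') = shuffle (fun x y => f (v x y)) z z' := by
  refine bilin_ext (f := (shuffle v).compr₂ (push f)) (fun l l' => ?_) z z'
  have key : ∀ (n : ℕ) (l : List X) (l' : List Y), l.length + l'.length = n →
      push f (shuffle v (cell l) (cell l')) = shuffle (fun x y => f (v x y)) (cell l) (cell l') := by
    intro n
    induction n with
    | zero =>
      intro l l' h
      rw [List.length_eq_zero_iff.1 (by omega : l.length = 0)]; simp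
    | succ n ih =>
      rintro (_ | ⟨x, l⟩) (_ | ⟨y, l'⟩) h
      · simp
      · simp
      · simp
      · simp only [List.length_cons] at h
        have h1 := ih l (y :: l') (by simp; omega)
        have h2 := ih (x :: l) l' (by simp; omega)
        rw [shuffle_cons_cons, shuffle_cons_cons, push_pre]
        simp only [map_add, map_smul, h1, h2, push_cell, List.map_nil]
  exact key _ l l' rfl

theorem shuffle_push (v : X → Y → Z) (f : V → X) (g : W → Y) (z : LChain V) (z' : LChain W) :
    shuffle v (push f z) (push g z') = shuffle (fun x y => v (f x) (g y)) z z' := by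
  refine bilin_ext (f := (shuffle v).compl₁₂ (push f) (push g)) (fun l l' => ?_) z z'
  have key : ∀ (n : ℕ) (l : List V) (l' : List W), l.length + l'.length = n →
      shuffle v (push f (cell l)) (push g (cell l')) =
        shuffle (fun x y => v (f x) (g y)) (cell l) (cell l') := by
    intro n
    induction n with
    | zero =>
      intro l l' h
      rw [List.length_eq_zero_iff.1 (by omega : l.length = 0)]; simp
    | succ n ih =>
      rintro (_ | ⟨x, l⟩) (_ | ⟨y, l'⟩) h
      · simp
      · simp
      · simp
      · simp only [List.length_cons] at h
        have h1 := ih l (y :: l') (by simp; omega)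
        have h2 := ih (x :: l) l' (by simp; omega)
        have e1 := emptyCoeff_push f (cell l)
        have e2 := emptyCoeff_push g (cell l')
        simp only [push_cell, List.map_cons] at h1 h2 e1 e2 ⊢
        rw [shuffle_cons_cons, shuffle_cons_cons, h1, h2, e1, e2, List.length_map]
  exact key _ l l' rfl

/-- Lattice paths through a p × q grid are counted by their first step, which is Pascal's rule. -/
theorem bdd_shuffle_cell (v : X → Y → Z) (p q : ℕ) (l : List X) (l' : List Y)
    (hl : l.length = p + 1) (hl' : l'.length = q + 1) :
    Bdd (p + q + 1) ((p + q).choose p) (shuffle v (cell l) (cell l')) := by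
  match l, l', p, q with
  | [x], l', 0, q =>
    obtain ⟨y, l', rfl⟩ := List.exists_cons_of_length_eq_add_one hl'
    rw [shuffle_singleton_left]
    simpa using Bdd.cell (by simpa using hl')
  | x :: x' :: l, [y], p + 1, 0 =>
    rw [shuffle_singleton_right]
    simpa using Bdd.cell (by simpa using hl)
  | x :: x' :: l, y :: y' :: l', p + 1, q + 1 =>
    rw [shuffle_cons_cons]
    simp only [emptyCoeff_cons, mul_zero, zero_smul, zero_add]
    have h1 := bdd_shuffle_cell v p (q + 1) (x' :: l) (y :: y' :: l') (by simpa using hl) hl'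
    have h2 := bdd_shuffle_cell v (p + 1) q (x :: x' :: l) (y' :: l') hl (by simpa using hl')
    rw [show p + 1 + (q + 1) = p + (q + 1) + 1 by ring, Nat.choose_succ_succ]
    refine (h1.add ?_).pre _
    rw [show p + (q + 1) = p + 1 + q by ring]
    exact h2.smul_sign _
  | [], _, _, _ => simp at hl
  | _ :: _, [], _, _ => simp at hl'
  | [_], _, _ + 1, _ => simp at hl
  | _ :: _ :: _, _, 0, _ => simp at hl
  | _ :: _ :: _, [_], _ + 1, _ + 1 => simp at hl'
  | _ :: _ :: _, _ :: _ :: _, _ + 1, 0 => simp at hl'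
termination_by l.length + l'.length

theorem bdd_shuffle (v : X → Y → Z) {p q K K' : ℕ} {z : LChain X} {z' : LChain Y}
    (h : Bdd (p + 1) K z) (h' : Bdd (q + 1) K' z') :
    Bdd (p + q + 1) (K * (K' * (p + q).choose p)) (shuffle v z z') :=
  h.map ((shuffle v).flip z') fun l hl =>
    h'.map (shuffle v (cell l)) fun l' hl' => bdd_shuffle_cell v p q l l' hl hl'

end ListChain
end

noncomputable section

namespace ListChain

variable {V W X Y Z N : Type*} [AddCommGroup N]

/-! ### The Alexander–Whitney diagonal -/

/-- The sum of a bilinear map over all front and back faces. -/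
def aw (B : LChain V →ₗ[ℤ] LChain V →ₗ[ℤ] N) : LChain V →ₗ[ℤ] N :=
  lext fun l => ∑ i ∈ Finset.range l.length, B (cell (l.take (i + 1))) (cell (l.drop i))

theorem aw_cell (B : LChain V →ₗ[ℤ] LChain V →ₗ[ℤ] N) (l : List V) :
    aw B (cell l) =
      ∑ i ∈ Finset.range l.length, B (cell (l.take (i + 1))) (cell (l.drop i)) := by
  simp [aw]

@[simp] theorem aw_nil (B : LChain V →ₗ[ℤ] LChain V →ₗ[ℤ] N) : aw B (cell []) = 0 := by
  simp [aw_cell]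

theorem aw_cons (B : LChain V →ₗ[ℤ] LChain V →ₗ[ℤ] N) (x : V) (l : List V) :
    aw B (cell (x :: l)) = B (cell [x]) (cell (x :: l)) + aw (B ∘ₗ pre x) (cell l) := by
  rw [aw_cell, aw_cell, List.length_cons, Finset.sum_range_succ', add_comm]
  simp

theorem aw_pre (B : LChain V →ₗ[ℤ] LChain V →ₗ[ℤ] N) (x : V) (z : LChain V) :
    aw B (pre x z) = B (cell [x]) (pre x z) + aw (B ∘ₗ pre x) z :=
  apply_ext (f := aw B ∘ₗ pre x) (g := B (cell [x]) ∘ₗ pre x + aw (B ∘ₗ pre x))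
    (by simp [aw_cons]) z

theorem aw_congr {B B' : LChain V →ₗ[ℤ] LChain V →ₗ[ℤ] N} {l : List V}
    (h : ∀ i < l.length, ∀ f r : List V, f.length = i + 1 → r.length = l.length - i →
      B (cell f) (cell r) = B' (cell f) (cell r)) : aw B (cell l) = aw B' (cell l) := by
  rw [aw_cell, aw_cell]
  refine Finset.sum_congr rfl fun i hi => ?_
  rw [Finset.mem_range] at hi
  exact h i hi _ _ (by simp; omega) (by simp)

theorem map_aw {N' : Type*} [AddCommGroup N'] (F : N →ₗ[ℤ] N')
    (B : LChain V →ₗ[ℤ] LChain V →ₗ[ℤ] N) (z : LChain V) :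
    F (aw B z) = aw (B.compr₂ F) z :=
  apply_ext (f := F ∘ₗ aw B) (g := aw (B.compr₂ F)) (by simp [aw_cell]) z

theorem aw_add (B B' : LChain V →ₗ[ℤ] LChain V →ₗ[ℤ] N) : aw (B + B') = aw B + aw B' :=
  hom_ext (by simp [aw_cell, Finset.sum_add_distrib])

theorem aw_neg (B : LChain V →ₗ[ℤ] LChain V →ₗ[ℤ] N) : aw (-B) = - aw B :=
  hom_ext (by simp [aw_cell])

theorem aw_sub (B B' : LChain V →ₗ[ℤ] LChain V →ₗ[ℤ] N) : aw (B - B') = aw B - aw B' := by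
  rw [sub_eq_add_neg, aw_add, aw_neg, ← sub_eq_add_neg]

theorem aw_push (B : LChain W →ₗ[ℤ] LChain W →ₗ[ℤ] N) (f : V → W) (z : LChain V) :
    aw B (push f z) = aw (B.compl₁₂ (push f) (push f)) z :=
  apply_ext (f := aw B ∘ₗ push f) (g := aw (B.compl₁₂ (push f) (push f)))
    (by simp [aw_cell, List.map_take, List.map_drop]) z

/-- Deleting the shared vertex from the front face and from the back face gives terms that cancel
between neighbouring cuts. The uncancelled ends, where one face has become empty, are the two
correction terms. -/
theorem aw_bd (B : LChain V →ₗ[ℤ] LChain V →ₗ[ℤ] N) (z : LChain V) :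
    aw B (bd z) = aw (B ∘ₗ bd - B.compl₁₂ sgn bd) z - B (cell []) z + B (sgn z) (cell []) := by
  refine apply_ext (f := aw B ∘ₗ bd)
    (g := aw (B ∘ₗ bd - B.compl₁₂ sgn bd) - B (cell []) + B.flip (cell []) ∘ₗ sgn) (fun l => ?_) z
  induction l generalizing B with
  | nil => simp
  | cons x l ih =>
    have h := ih (B ∘ₗ pre x)
    have e : (B ∘ₗ bd - B.compl₁₂ sgn bd) ∘ₗ pre x = B -
        ((B ∘ₗ pre x) ∘ₗ bd - (B ∘ₗ pre x).compl₁₂ sgn bd) := by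
      refine hom_ext fun f => hom_ext fun r => ?_
      simp
      abel
    simp only [LinearMap.comp_apply, LinearMap.add_apply, LinearMap.sub_apply,
      LinearMap.flip_apply] at h ⊢
    rw [bd_cons, map_sub, aw_pre, h, aw_cons _ x l, e]
    simp only [aw_sub, LinearMap.sub_apply]
    simp
    abel

/-! ### Subdivision of the diagonal -/

/-- The diagonal, subdivided into products of front and back faces. -/
def subdivision (v : X → X → Z) : LChain X →ₗ[ℤ] LChain Z :=
  aw (shuffle v) + LinearMap.toSpanSingleton ℤ _ (cell []) ∘ₗ emptyCoeff

/-- Both faces have a nonzero augmentation only when each is a single vertex, that is, when the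
simplex itself is one. -/
theorem aw_augmentation (z : LChain X) (w : N) :
    aw (((LinearMap.mul ℤ ℤ).compl₁₂ (emptyCoeff ∘ₗ bd) (emptyCoeff ∘ₗ bd)).compr₂
        (LinearMap.toSpanSingleton ℤ N w)) z = emptyCoeff (bd z) • w := by
  refine apply_ext (g := LinearMap.toSpanSingleton ℤ N w ∘ₗ emptyCoeff ∘ₗ bd) (fun l => ?_) z
  cases l with
  | nil => simp
  | cons x l =>
    rw [aw_cons, aw_congr (B' := 0)]
    · simp [aw_cell]
    · intro i hi f r hf hr
      cases f with
      | nil => simp at hf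
      | cons y f => simp

theorem bd_subdivision (v : X → X → Z) (z : LChain X) :
    bd (subdivision v z) = subdivision v (bd z) := by
  have e : (shuffle v).compr₂ bd = (shuffle v ∘ₗ bd - (shuffle v).compl₁₂ sgn bd) +
      ((LinearMap.mul ℤ ℤ).compl₁₂ (emptyCoeff ∘ₗ bd) (emptyCoeff ∘ₗ bd)).compr₂
        (LinearMap.toSpanSingleton ℤ _ (cell [])) :=
    hom_ext fun l => hom_ext fun l' => by simp [bd_shuffle]
  simp only [subdivision, LinearMap.add_apply, map_add, map_aw, e, aw_add, aw_augmentation,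
    aw_bd]
  simp

/-- The homotopy from the diagonal to its subdivision, on lists. -/
def ezList (v : X → X → Z) : List X → LChain Z
  | [] => 0
  | x :: l => - pre (v x x) (ezList v l + aw (shuffle v ∘ₗ pre x) (cell l))

/-- The homotopy from the diagonal to its subdivision. -/
def ez (v : X → X → Z) : LChain X →ₗ[ℤ] LChain Z := lext (ezList v)

@[simp] theorem ez_nil (v : X → X → Z) : ez v (cell []) = 0 := by simp [ez, ezList]

theorem ez_pre (v : X → X → Z) (x : X) (z : LChain X) :
    ez v (pre x z) = - pre (v x x) (ez v z + aw (shuffle v ∘ₗ pre x) z) :=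
  apply_ext (f := ez v ∘ₗ pre x) (g := - pre (v x x) ∘ₗ (ez v + aw (shuffle v ∘ₗ pre x)))
    (fun l => by simp [ez, ezList]) z

theorem subdivision_pre (v : X → X → Z) (x : X) (z : LChain X) :
    subdivision v (pre x z) = pre (v x x) (push (v x) z) + aw (shuffle v ∘ₗ pre x) z := by
  simp [subdivision, aw_pre, shuffle_singleton_left]

/-- The homotopy is the cone from the initial vertex `v x x` over the part of the required boundary
that does not already start there. The remaining part would contribute only degenerate cones, so it
is left out, which keeps the count small. -/
theorem bd_ez (v : X → X → Z) (z : LChain X) :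
    bd (ez v z) + ez v (bd z) = push (fun x => v x x) z - subdivision v z := by
  refine apply_ext (f := bd ∘ₗ ez v + ez v ∘ₗ bd) (g := push (fun x => v x x) - subdivision v)
    (fun l => ?_) z
  induction l with
  | nil => simp [subdivision]
  | cons x l ih =>
    simp only [LinearMap.add_apply, LinearMap.sub_apply, LinearMap.comp_apply] at ih ⊢
    have hS := bd_subdivision v (cell (x :: l))
    rw [bd_cons, map_sub] at hS
    rw [← pre_cell] at *
    rw [subdivision_pre, subdivision_pre, map_add, bd_pre] at hS
    rw [subdivision_pre, pre_cell, bd_cons, map_sub, ← pre_cell, ez_pre, ez_pre, map_neg, bd_pre,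
      map_add, push_pre]
    have e1 : bd (ez v (cell l)) = push (fun x => v x x) (cell l) - subdivision v (cell l) -
      ez v (bd (cell l)) := by rw [← ih]; abel
    have e2 : bd (aw (shuffle v ∘ₗ pre x) (cell l)) = subdivision v (cell l) -
      (pre (v x x) (push (v x) (bd (cell l))) + aw (shuffle v ∘ₗ pre x) (bd (cell l))) -
      (push (v x) (cell l) - pre (v x x) (bd (push (v x) (cell l)))) := by rw [← hS]; abel
    rw [e1, e2, push_bd]
    simp only [map_add, map_sub]
    abel

theorem push_ez (v : X → X → Z) (f : Z → W) (z : LChain X) :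
    push f (ez v z) = ez (fun x y => f (v x y)) z := by
  refine apply_ext (f := push f ∘ₗ ez v) (fun l => ?_) z
  induction l with
  | nil => simp
  | cons x l ih =>
    have e : (shuffle v ∘ₗ pre x).compr₂ (push f) = shuffle (fun x y => f (v x y)) ∘ₗ pre x :=
      hom_ext fun l => hom_ext fun l' => by simp [push_shuffle]
    rw [LinearMap.comp_apply] at ih ⊢
    rw [← pre_cell, ez_pre, ez_pre, map_neg, push_pre, map_add, ih, map_aw, e]

theorem ez_push (v : X → X → Z) (f : W → X) (z : LChain W) :
    ez v (push f z) = ez (fun x y => v (f x) (f y)) z := by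
  refine apply_ext (f := ez v ∘ₗ push f) (fun l => ?_) z
  induction l with
  | nil => simp
  | cons x l ih =>
    have e : (shuffle v ∘ₗ pre (f x)).compl₁₂ (push f) (push f) =
        shuffle (fun x y => v (f x) (f y)) ∘ₗ pre x :=
      hom_ext fun l => hom_ext fun l' => by
        rw [LinearMap.compl₁₂_apply, LinearMap.comp_apply, ← push_pre, shuffle_push]; rfl
    rw [LinearMap.comp_apply] at ih ⊢
    rw [← pre_cell, push_pre, ez_pre, ez_pre, ih, aw_push, e]

/-- Passing from degree m to m + 1 adds the shuffles with a nontrivial front part, 2^(m+1) - 1 in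
number; the bound solves this recursion from 0. -/
theorem bdd_ez_cell (v : X → X → Z) (m : ℕ) (l : List X) (hl : l.length = m + 1) :
    Bdd (m + 2) (2 ^ (m + 1) - 2 - m) (ez v (cell l)) := by
  induction m generalizing l with
  | zero =>
    obtain ⟨x, rfl⟩ := List.length_eq_one_iff.1 hl
    rw [← pre_cell, ez_pre]
    simpa using Bdd.zero _
  | succ m ih =>
    obtain ⟨x, l, rfl⟩ := List.exists_cons_of_length_eq_add_one hl
    have hl' : l.length = m + 1 := by simpa using hl
    rw [← pre_cell, ez_pre]
    have h1 := ih l hl'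
    have h2 : Bdd (m + 2) (∑ i ∈ Finset.range (m + 1), (m + 1).choose (i + 1))
        (aw (shuffle v ∘ₗ pre x) (cell l)) := by
      rw [aw_cell, hl']
      refine Bdd.sum _ fun i hi => ?_
      have hi' : i < m + 1 := Finset.mem_range.1 hi
      rw [LinearMap.comp_apply, pre_cell]
      have h := bdd_shuffle_cell v (i + 1) (m - i) (x :: l.take (i + 1)) (l.drop i)
        (by simp; omega) (by simp; omega)
      rwa [show i + 1 + (m - i) = m + 1 by omega] at h
    have hs : ∑ i ∈ Finset.range (m + 1), (m + 1).choose (i + 1) + 1 = 2 ^ (m + 1) := by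
      rw [← Nat.sum_range_choose (m + 1), Finset.sum_range_succ' _ (m + 1)]
      simp
    have hm : m + 2 ≤ 2 ^ (m + 1) := Nat.lt_two_pow_self
    refine (((h1.add h2).pre _).neg).mono ?_
    rw [pow_succ 2 (m + 1)]
    omega

/-! ### Prisms -/

/-- The prism homotopy between two maps of vertices, on lists. -/
def prismList (φ ψ : X → Z) : List X → LChain Z
  | [] => 0
  | x :: l => pre (φ x) (cell ((x :: l).map ψ) - prismList φ ψ l)

/-- The prism homotopy between two maps of vertices. -/
def prism (φ ψ : X → Z) : LChain X →ₗ[ℤ] LChain Z := lext (prismList φ ψ)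

@[simp] theorem prism_nil (φ ψ : X → Z) : prism φ ψ (cell []) = 0 := by simp [prism, prismList]

theorem prism_pre (φ ψ : X → Z) (x : X) (z : LChain X) :
    prism φ ψ (pre x z) = pre (φ x) (pre (ψ x) (push ψ z) - prism φ ψ z) :=
  apply_ext (f := prism φ ψ ∘ₗ pre x) (g := pre (φ x) ∘ₗ (pre (ψ x) ∘ₗ push ψ - prism φ ψ))
    (fun l => by simp [prism, prismList]) z

theorem bd_prism (φ ψ : X → Z) (z : LChain X) :
    bd (prism φ ψ z) + prism φ ψ (bd z) = push ψ z - push φ z := by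
  refine apply_ext (f := bd ∘ₗ prism φ ψ + prism φ ψ ∘ₗ bd) (g := push ψ - push φ)
    (fun l => ?_) z
  induction l with
  | nil => simp
  | cons x l ih =>
    simp only [LinearMap.add_apply, LinearMap.sub_apply, LinearMap.comp_apply] at ih ⊢
    have e1 : bd (prism φ ψ (cell l)) = push ψ (cell l) - push φ (cell l) -
      prism φ ψ (bd (cell l)) := by rw [← ih]; abel
    rw [bd_cons, map_sub, ← pre_cell, prism_pre, prism_pre, bd_pre, map_sub bd, e1, bd_pre,
      ← push_bd, push_pre, push_pre]
    simp only [map_sub]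
    abel

theorem push_prism (φ ψ : X → Z) (f : Z → W) (z : LChain X) :
    push f (prism φ ψ z) = prism (fun x => f (φ x)) (fun x => f (ψ x)) z := by
  refine apply_ext (f := push f ∘ₗ prism φ ψ) (fun l => ?_) z
  induction l with
  | nil => simp
  | cons x l ih =>
    rw [LinearMap.comp_apply] at ih ⊢
    rw [← pre_cell, prism_pre, prism_pre, push_pre, map_sub, ih, push_pre, push_push]

theorem prism_push (φ ψ : X → Z) (f : W → X) (z : LChain W) :
    prism φ ψ (push f z) = prism (fun x => φ (f x)) (fun x => ψ (f x)) z := by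
  refine apply_ext (f := prism φ ψ ∘ₗ push f) (fun l => ?_) z
  induction l with
  | nil => simp
  | cons x l ih =>
    rw [LinearMap.comp_apply] at ih ⊢
    rw [← pre_cell, push_pre, prism_pre, prism_pre, ih, push_push]

theorem bdd_prism_cell (φ ψ : X → Z) (l : List X) :
    Bdd (l.length + 1) l.length (prism φ ψ (cell l)) := by
  induction l with
  | nil => simpa using Bdd.zero _
  | cons x l ih =>
    have h : Bdd (l.length + 1) 1 (push ψ (cell (x :: l))) := Bdd.push (.cell (by simp)) ψ
    rw [← pre_cell, prism_pre, sub_eq_neg_add, ← push_pre, pre_cell]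
    exact (ih.neg.add h).pre (φ x)

end ListChain
end

noncomputable section

namespace ListChain

variable {V W : Type*} {G K A : Type*} [Group G] [Group K] [Group A]

/-! ### Truncation -/

/-- The projection to the chains of lists with at least two entries. -/
def trunc : LChain V →ₗ[ℤ] LChain V := lext fun l => if 2 ≤ l.length then cell l else 0

theorem trunc_cell (l : List V) : trunc (cell l) = if 2 ≤ l.length then cell l else 0 := by
  simp [trunc]

@[simp] theorem trunc_nil : trunc (cell ([] : List V)) = 0 := by simp [trunc]

@[simp] theorem trunc_singleton (x : V) : trunc (cell [x]) = 0 := by simp [trunc]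

@[simp] theorem trunc_cons_cons (x y : V) (l : List V) :
    trunc (cell (x :: y :: l)) = cell (x :: y :: l) := by simp [trunc]

theorem trunc_push (f : V → W) (z : LChain V) : trunc (push f z) = push f (trunc z) :=
  apply_ext (f := trunc ∘ₗ push f) (g := push f ∘ₗ trunc)
    (fun l => by rcases l with _ | ⟨x, _ | ⟨y, l⟩⟩ <;> simp) z

theorem bdd_bd_cell (x : V) (l : List V) : Bdd l.length (l.length + 1) (bd (cell (x :: l))) := by
  induction l generalizing x with
  | nil => simpa using Bdd.cell (l := ([] : List V)) rfl
  | cons y l ih =>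
    have h := ((ih y).pre x).neg.add (Bdd.cell (l := y :: l) rfl)
    rw [bd_cons, sub_eq_neg_add]
    exact h

/-- Only the last cut has a single vertex as back face, so truncating back faces loses exactly that
summand. -/
theorem aw_eq_aw_trunc_add {N : Type*} [AddCommGroup N] (B : LChain V →ₗ[ℤ] LChain V →ₗ[ℤ] N)
    (x : V) (l : List V) :
    ∃ y, aw B (cell (x :: l)) =
      aw (B.compl₁₂ LinearMap.id trunc) (cell (x :: l)) + B (cell (x :: l)) (cell [y]) := by
  induction l generalizing x B with
  | nil => exact ⟨x, by simp [aw_cons]⟩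
  | cons y l ih =>
    obtain ⟨w, hw⟩ := ih (B ∘ₗ pre x) y
    refine ⟨w, ?_⟩
    rw [aw_cons, hw, aw_cons _ x]
    have e : (B ∘ₗ pre x).compl₁₂ LinearMap.id trunc = B.compl₁₂ LinearMap.id trunc ∘ₗ pre x :=
      rfl
    rw [e]
    simp [add_assoc]

/-! ### Normalization by translation -/

/-- Translating each simplex so that it starts at the identity. Two chains become equal under this
map exactly if they induce the same chain of the bar construction. -/
def normalize : LChain G →ₗ[ℤ] LChain G :=
  lext fun l => cell (l.map fun y => (l.headD 1)⁻¹ * y)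

theorem normalize_cell (l : List G) :
    normalize (cell l) = push (fun y => (l.headD 1)⁻¹ * y) (cell l) := by simp [normalize]

theorem normalize_translate (g : G) (z : LChain G) :
    normalize (push (fun x => g * x) z) = normalize z :=
  apply_ext (f := normalize ∘ₗ push fun x => g * x) (g := normalize)
    (fun l => by cases l <;> simp [normalize_cell, mul_assoc, Function.comp_def]) z

/-- The linear map `F` is well defined on chains modulo translation. -/
def Descends (F : LChain G →ₗ[ℤ] LChain K) : Prop :=
  ∀ (g : G) (z : LChain G), normalize (F (push (fun x => g * x) z)) = normalize (F z)

theorem Descends.normalize {F : LChain G →ₗ[ℤ] LChain K} (hF : Descends F) (z : LChain G) :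
    normalize (F (normalize z)) = normalize (F z) :=
  apply_ext (f := ListChain.normalize ∘ₗ F ∘ₗ ListChain.normalize) (g := ListChain.normalize ∘ₗ F)
    (fun l => by simpa only [LinearMap.comp_apply, normalize_cell l] using hF _ _) z

theorem Descends.congr {F : LChain G →ₗ[ℤ] LChain K} (hF : Descends F) {z z' : LChain G}
    (h : ListChain.normalize z = ListChain.normalize z') :
    ListChain.normalize (F z) = ListChain.normalize (F z') := by
  rw [← hF.normalize z, h, hF.normalize]

theorem descends_of_equivariant {F : LChain G →ₗ[ℤ] LChain K} (k : G → K)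
    (h : ∀ g z, F (push (fun x => g * x) z) = push (fun x => k g * x) (F z)) : Descends F :=
  fun g z => by rw [h, normalize_translate]

theorem push_hom_translate (k : G →* K) (g : G) (z : LChain G) :
    push k (push (fun x => g * x) z) = push (fun x => k g * x) (push k z) := by
  simp [push_push]

theorem descends_push (k : G →* K) : Descends (push k : LChain G →ₗ[ℤ] LChain K) :=
  descends_of_equivariant k fun g z => push_hom_translate k g z

/-- The only obstruction is the boundary of an edge, a difference of two vertices, which vanishes
because all vertices are translates of one another. -/
theorem normalize_trunc_bd (z : LChain G) :
    normalize (trunc (bd z)) = normalize (bd (trunc z)) := by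
  refine apply_ext (f := normalize ∘ₗ trunc ∘ₗ bd) (g := normalize ∘ₗ bd ∘ₗ trunc)
    (fun l => ?_) z
  rcases l with _ | ⟨x, _ | ⟨y, _ | ⟨w, l⟩⟩⟩
  · simp
  · simp
  · simp [normalize_cell]
  · simp only [LinearMap.comp_apply, trunc_cons_cons]
    congr 1
    refine (bdd_bd_cell x (y :: w :: l)).eqOn (F' := LinearMap.id) fun l' hl' => ?_
    rw [trunc_cell, if_pos (by simp at hl'; omega)]
    rfl

theorem Descends.trunc_bd {F : LChain G →ₗ[ℤ] LChain K} (hF : Descends F) (z : LChain G) :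
    ListChain.normalize (F (trunc (bd z))) = ListChain.normalize (F (bd (trunc z))) :=
  hF.congr (normalize_trunc_bd z)

/-! ### Products of commuting homomorphisms -/

/-- The vertex map of the product of two homomorphisms. -/
abbrev prodMap (α β : K →* A) : K → K → A := fun x y => α x * β y

theorem prodMap_mul_left (α β : K →* A) (g x y : K) :
    prodMap α β (g * x) y = α g * prodMap α β x y := by
  simp [prodMap, mul_assoc]

theorem prodMap_mul_right {α β : K →* A} (hc : ∀ x y, Commute (α x) (β y)) (g x y : K) :
    prodMap α β x (g * y) = β g * prodMap α β x y := by
  rw [prodMap, map_mul, (hc _ _).left_comm]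

/-- The two factors may be translated independently: moving the first by g moves the product by α g,
and moving the second moves it by β g because β g passes through the values of α. -/
theorem normalize_shuffle_congr {α β : K →* A} (hc : ∀ x y, Commute (α x) (β y))
    {z w z' w' : LChain K} (h : normalize z = normalize w) (h' : normalize z' = normalize w') :
    normalize (shuffle (prodMap α β) z z') = normalize (shuffle (prodMap α β) w w') := by
  have push_id : ∀ z : LChain K, push (fun x => x) z = z := fun z =>
    apply_ext (g := LinearMap.id) (by simp) z
  have h1 : Descends ((shuffle (prodMap α β)).flip z') :=
    descends_of_equivariant α fun g z => by
      rw [LinearMap.flip_apply, LinearMap.flip_apply, push_shuffle]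
      -- The untouched factor is written as a pushforward along the identity so that `shuffle_push`
      -- applies.
      conv_lhs => rw [← push_id z', shuffle_push]
      simp only [prodMap_mul_left]
  have h2 : Descends (shuffle (prodMap α β) w) :=
    descends_of_equivariant β fun g z => by
      rw [push_shuffle]
      conv_lhs => rw [← push_id w, shuffle_push]
      simp only [prodMap_mul_right hc]
  rw [← h2.congr h']
  exact h1.congr h

/-- In positive degree, the two extreme cuts have a single vertex as front or back face and give
translates of β and of α. The final summand covers degrees at most 0, where truncation removes
everything else. -/
theorem normalize_subdivision {α β : K →* A} (hc : ∀ x y, Commute (α x) (β y)) (z : LChain K) :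
    normalize (subdivision (prodMap α β) z) =
      normalize (aw ((shuffle (prodMap α β)).compl₁₂ trunc trunc) z + push α (trunc z) +
        push β (trunc z) + push (fun x => α x * β x) (z - trunc z)) := by
  suffices H : normalize ∘ₗ subdivision (prodMap α β) =
      normalize ∘ₗ (aw ((shuffle (prodMap α β)).compl₁₂ trunc trunc) + push α ∘ₗ trunc +
        push β ∘ₗ trunc + push (fun x => α x * β x) ∘ₗ (LinearMap.id - trunc)) by
    simpa only [LinearMap.comp_apply, LinearMap.add_apply, LinearMap.sub_apply,
      LinearMap.id_apply] using LinearMap.congr_fun H z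
  refine hom_ext fun l => ?_
  rcases l with _ | ⟨x, _ | ⟨y, l⟩⟩
  · simp [subdivision]
  · simp [subdivision, aw_cons, shuffle_singleton_left]
  · obtain ⟨w, hw⟩ := aw_eq_aw_trunc_add (shuffle (prodMap α β) ∘ₗ pre x) y l
    have e : aw ((shuffle (prodMap α β) ∘ₗ pre x).compl₁₂ LinearMap.id trunc) (cell (y :: l)) =
        aw ((shuffle (prodMap α β)).compl₁₂ trunc trunc ∘ₗ pre x) (cell (y :: l)) := by
      refine aw_congr fun i _ f r hf _ => ?_
      obtain ⟨a, f, rfl⟩ := List.exists_cons_of_length_eq_add_one hf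
      simp
    have e1 : push (fun y => α x * β y) (cell (x :: y :: l)) =
        push (fun y => α x * y) (push β (cell (x :: y :: l))) := by rw [push_push]
    have e2 : push (fun y => α y * β w) (cell (x :: y :: l)) =
        push (fun y => β w * y) (push α (cell (x :: y :: l))) := by
      rw [push_push]; simp only [(hc _ _).eq]
    simp only [LinearMap.comp_apply, LinearMap.add_apply, LinearMap.sub_apply, subdivision,
      LinearMap.id_apply]
    rw [aw_cons _ x, aw_cons _ x, hw, e, LinearMap.comp_apply, pre_cell, shuffle_singleton_left,
      shuffle_singleton_right, e1, e2]
    simp only [trunc_cons_cons, map_add, emptyCoeff_cons, zero_smul, sub_zero, sub_self, map_zero,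
      normalize_translate, LinearMap.compl₁₂_apply, trunc_singleton, LinearMap.zero_apply,
      zero_add, add_zero]
    abel

/-! ### The inductive step -/

/-- A null homotopy of the chain map induced by `k` on the bar construction, in positive degrees
up to `n`, with diameter less than `γ m` on simplices of degree `m`. -/
structure IsNullHomotopy (k : G →* K) (n : ℕ) (γ : ℕ → ℕ) (Θ : LChain G →ₗ[ℤ] LChain K) :
    Prop where
  bdd : ∀ l, Bdd (l.length + 1) (γ (l.length - 1) - 1) (Θ (cell l))
  descends : Descends Θ
  comm : ∀ l, l.length ≤ n + 1 → normalize (bd (Θ (cell l)) + Θ (bd (cell l))) =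
    normalize (push k (trunc (cell l)))

/-- The product of a null homotopy with a chain map, pulled back along the diagonal. -/
def crossTerm (α β : K →* A) (k : G →* K) (Θ : LChain G →ₗ[ℤ] LChain K) :
    LChain G →ₗ[ℤ] LChain A :=
  aw ((shuffle (prodMap α β)).compl₁₂ Θ (push k ∘ₗ trunc))

theorem descends_crossTerm {α β : K →* A} (hc : ∀ x y, Commute (α x) (β y)) (k : G →* K)
    {Θ : LChain G →ₗ[ℤ] LChain K} (hΘ : Descends Θ) : Descends (crossTerm α β k Θ) := by
  intro g z
  rw [crossTerm, aw_push, map_aw, map_aw]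
  congr 2
  refine hom_ext fun f => hom_ext fun r => normalize_shuffle_congr hc (hΘ g _) ?_
  simp only [LinearMap.comp_apply]
  rw [trunc_push]
  exact descends_push k g _

/-- The product of a null homotopy with a chain map is a null homotopy of the product. The right
factor is a chain map only modulo translation, because of the truncation, hence the normalization.
-/
theorem normalize_bd_crossTerm {α β : K →* A} (hc : ∀ x y, Commute (α x) (β y)) {k : G →* K}
    {n : ℕ} {γ : ℕ → ℕ} (hγ : γ 0 = 0) {Θ : LChain G →ₗ[ℤ] LChain K}
    (h : IsNullHomotopy k n γ Θ) (l : List G) (hl : l.length ≤ n + 2) :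
    normalize (bd (crossTerm α β k Θ (cell l)) + crossTerm α β k Θ (bd (cell l))) =
      normalize (aw ((shuffle (prodMap α β)).compl₁₂ trunc trunc) (push k (cell l))) := by
  have h0 : Θ (cell []) = 0 := by
    have := h.bdd []
    simp only [List.length_nil, zero_tsub, hγ] at this
    exact this.eq_zero
  rw [crossTerm, aw_bd, map_aw, aw_push]
  simp only [LinearMap.compl₁₂_apply, LinearMap.comp_apply, h0, trunc_nil, map_zero,
    LinearMap.zero_apply, sub_zero, add_zero]
  rw [← LinearMap.add_apply, ← aw_add, map_aw, map_aw]
  refine aw_congr fun i hi f r hf hr => ?_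
  obtain ⟨a, f, rfl⟩ := List.exists_cons_of_length_eq_add_one hf
  obtain ⟨b, r, rfl⟩ := List.exists_cons_of_length_eq_add_one
    (show r.length = (l.length - i - 1) + 1 by omega)
  simp only [LinearMap.compr₂_apply, LinearMap.add_apply, LinearMap.sub_apply,
    LinearMap.compl₁₂_apply, LinearMap.comp_apply]
  rcases r with _ | ⟨c, r⟩
  · simp
  · have hT := h.bdd (a :: f)
    -- The lists in Θ of a nonempty list have at least two vertices, so the augmentation term of the
    -- Leibniz rule vanishes.
    have hη : emptyCoeff (bd (Θ (cell (a :: f)))) = 0 := by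
      refine hT.eqOn (F := emptyCoeff ∘ₗ bd) (F' := 0) fun l' hl' => ?_
      rcases l' with _ | ⟨x, _ | ⟨y, l'⟩⟩
      · simp
      · simp at hl'
      · simp
    have hs : sgn (Θ (cell (a :: f))) = - Θ (sgn (cell (a :: f))) := by
      rw [sgn_cell, map_smul]
      have := hT.eqOn (F := sgn) (F' := (-1 : ℤ) ^ ((a :: f).length + 1) • LinearMap.id)
        fun l' hl' => by rw [sgn_cell, hl']; rfl
      rw [this, LinearMap.smul_apply, LinearMap.id_apply, pow_succ, mul_neg_one, neg_smul]
    -- The back face has at least two vertices and shares only one with the front face, so the front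
    -- face has at most n + 1 vertices: this is the gain of one degree.
    have e1 := h.comm (a :: f) (by simp at hf hr ⊢; omega)
    have e2 : normalize (bd (push k (trunc (cell (b :: c :: r)))) -
        push k (trunc (bd (cell (b :: c :: r))))) = normalize 0 := by
      rw [map_sub, (descends_push k).trunc_bd, ← push_bd, sub_self, map_zero]
    have e3 := normalize_shuffle_congr hc (z := Θ (sgn (cell (a :: f)))) rfl e2
    have e4 := normalize_shuffle_congr hc (z' := push k (trunc (cell (b :: c :: r)))) e1 rfl
    rw [bd_shuffle, hη, hs, trunc_push, trunc_push, ← e4]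
    simp only [map_sub, map_add, map_zero, map_neg, LinearMap.neg_apply, LinearMap.add_apply,
      zero_mul, zero_smul, add_zero] at e3 ⊢
    rw [sub_eq_zero] at e3
    rw [e3]
    abel

/-- A cut at i shuffles a chain of dimension i + 1 with a simplex of dimension m - i. The cut at 0
drops out since Θ vanishes there, and the cut at m drops out by truncation. -/
theorem bdd_crossTerm {α β : K →* A} {k : G →* K} {n : ℕ} {γ : ℕ → ℕ} (hγ : γ 0 = 0)
    {Θ : LChain G →ₗ[ℤ] LChain K} (h : IsNullHomotopy k n γ Θ) (m : ℕ) (l : List G)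
    (hl : l.length = m + 1) :
    Bdd (m + 2) (∑ i ∈ Finset.Icc 1 (m - 1), γ i * (m + 1).choose (m - i))
      (crossTerm α β k Θ (cell l)) := by
  have hsum : ∑ i ∈ Finset.Icc 1 (m - 1), γ i * (m + 1).choose (m - i) =
      ∑ i ∈ Finset.range (m + 1),
        if i ∈ Finset.Icc 1 (m - 1) then γ i * (m + 1).choose (m - i) else 0 := by
    rw [← Finset.sum_filter]
    congr 1
    ext i
    simp only [Finset.mem_filter, Finset.mem_range, Finset.mem_Icc]
    omega
  rw [hsum, crossTerm, aw_cell, hl]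
  refine Bdd.sum _ fun i hi => ?_
  have hi' : i < m + 1 := Finset.mem_range.1 hi
  have h1 := h.bdd (l.take (i + 1))
  rw [List.length_take_of_le (by omega), Nat.add_sub_cancel] at h1
  rw [LinearMap.compl₁₂_apply, LinearMap.comp_apply]
  split_ifs with hm
  · have h2 : Bdd (m - i + 1) 1 (push k (trunc (cell (l.drop i)))) := by
      rw [trunc_cell, if_pos (by rw [Finset.mem_Icc] at hm; simp; omega)]
      exact Bdd.push (.cell (by simp; omega)) _
    have h3 := bdd_shuffle (prodMap α β) h1 h2
    rw [show i + 1 + (m - i) = m + 1 by omega, one_mul] at h3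
    -- Shuffles are counted by the steps of the first factor, the recursion for γ by those of the
    -- second.
    rw [Nat.choose_symm_of_eq_add (show m + 1 = m - i + (i + 1) by omega)]
    exact h3.mono (Nat.mul_le_mul_right _ (Nat.sub_le _ _))
  · rw [Finset.mem_Icc] at hm
    rcases (by omega : i = 0 ∨ i = m) with rfl | rfl
    · rw [hγ] at h1
      rw [h1.eq_zero]
      simpa using Bdd.zero 0
    · rw [trunc_cell, if_neg (by simp; omega)]
      simpa using Bdd.zero 0

/-- The null homotopy of `α ∘ k` obtained from one of `k`. -/
def stepHomotopy (α β : K →* A) (s : A) (k : G →* K) (Θ : LChain G →ₗ[ℤ] LChain K) :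
    LChain G →ₗ[ℤ] LChain A :=
  prism β (fun x => β x * s⁻¹) ∘ₗ push k ∘ₗ trunc - ez (prodMap α β) ∘ₗ push k -
    crossTerm α β k Θ

/-- In positive degrees the three parts of the homotopy contribute αβ - β, then α + β + cross - αβ,
then -cross, and the sum is α. -/
theorem IsNullHomotopy.step {α β : K →* A} (hc : ∀ x y, Commute (α x) (β y)) {s : A}
    (hs : ∀ x, s * β x * s⁻¹ = α x * β x) {k : G →* K} {n : ℕ} {γ : ℕ → ℕ} (hγ : γ 0 = 0)
    (hγs : ∀ m, 1 ≤ m → γ m = 2 ^ m * (m + 1) +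
      ∑ i ∈ Finset.Icc 1 (m - 1), γ i * (m + 1).choose (m - i))
    {Θ : LChain G →ₗ[ℤ] LChain K} (h : IsNullHomotopy k n γ Θ) :
    IsNullHomotopy (α.comp k) (n + 1) γ (stepHomotopy α β s k Θ) := by
  have hP : Descends (prism β (fun x => β x * s⁻¹) ∘ₗ push k) :=
    descends_of_equivariant (fun g => β (k g)) fun g z => by
      rw [LinearMap.comp_apply, LinearMap.comp_apply, push_hom_translate, prism_push, push_prism]
      simp [mul_assoc]
  have hE : Descends (ez (prodMap α β) ∘ₗ push k) :=
    descends_of_equivariant (fun g => β (k g) * α (k g)) fun g z => by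
      rw [LinearMap.comp_apply, LinearMap.comp_apply, push_hom_translate, ez_push, push_ez]
      simp only [prodMap_mul_left, prodMap_mul_right hc, mul_assoc]
  have hX := descends_crossTerm hc k h.descends (β := β)
  refine ⟨fun l => ?_, fun g z => ?_, fun l hl => ?_⟩
  · rcases l with _ | ⟨x, l⟩
    · simpa [stepHomotopy, crossTerm] using Bdd.zero _
    · have h1 : Bdd (l.length + 2) (if l.length = 0 then 0 else l.length + 1)
          (prism β (fun x => β x * s⁻¹) (push k (trunc (cell (x :: l))))) := by
        rcases l with _ | ⟨y, l⟩
        · simpa using Bdd.zero 0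
        · rw [trunc_cons_cons, push_cell]
          simpa using bdd_prism_cell β (fun x => β x * s⁻¹) ((x :: y :: l).map k)
      have h2 : Bdd (l.length + 2) (2 ^ (l.length + 1) - 2 - l.length)
          (ez (prodMap α β) (push k (cell (x :: l)))) := by
        rw [push_cell]
        exact bdd_ez_cell _ _ _ (by simp)
      have h3 := bdd_crossTerm (α := α) (β := β) hγ h l.length (x :: l) rfl
      rw [stepHomotopy, LinearMap.sub_apply, LinearMap.sub_apply, sub_eq_add_neg, sub_eq_add_neg]
      refine ((h1.add h2.neg).add h3.neg).mono ?_
      rw [List.length_cons, Nat.add_sub_cancel]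
      rcases Nat.eq_zero_or_pos l.length with h0 | h0
      · simp [h0]
      · rw [hγs _ h0, if_neg (by omega)]
        -- Prism and subdivision together have at most 2^(m+1) - 1 simplices, which for m ≥ 1 is at
        -- most 2^m(m + 1) - 1.
        have h4 : 2 ^ l.length * 2 ≤ 2 ^ l.length * (l.length + 1) :=
          Nat.mul_le_mul_left _ (by omega)
        have h5 : l.length < 2 ^ l.length := Nat.lt_two_pow_self
        rw [pow_succ]
        omega
  · simp only [stepHomotopy, LinearMap.sub_apply, map_sub]
    rw [hX g z]
    congr 2
    · simp only [LinearMap.comp_apply]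
      rw [trunc_push]
      exact hP g (trunc z)
    · exact hE g z
  · have e1 := hP.trunc_bd (cell l)
    have e2 := bd_prism β (fun x => β x * s⁻¹) (push k (trunc (cell l)))
    have e3 := bd_ez (prodMap α β) (push k (cell l))
    have e4 := normalize_bd_crossTerm hc hγ h l hl (β := β)
    have e5 := normalize_subdivision hc (push k (cell l)) (β := β)
    -- Left translation by s turns βx · s⁻¹ into the conjugate of βx, which is αx · βx.
    have e6 : normalize (push (fun x => α x * β x) (push k (trunc (cell l)))) =
        normalize (push (fun x => β x * s⁻¹) (push k (trunc (cell l)))) := by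
      rw [← normalize_translate s (push (fun x => β x * s⁻¹) _),
        push_push (fun x => β x * s⁻¹)]
      simp only [← hs, mul_assoc]
    have e7 : push (α.comp k) (trunc (cell l)) = push α (push k (trunc (cell l))) := by
      rw [push_push]; rfl
    apply_fun normalize at e2 e3
    rw [← push_bd] at e2 e3
    rw [e7]
    simp only [stepHomotopy, LinearMap.sub_apply, LinearMap.comp_apply, map_sub, map_add,
      trunc_push] at e1 e2 e3 e4 e5 e6 ⊢
    linear_combination (norm := abel) e1 + e2 - e3 - e4 + e5 - e6

end ListChain
end

noncomputable section

namespace ListChain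

/-! ### Comparison with the bar construction -/

section Comparison

variable {G K : Type u} [Group G] [Group K]

/-- The tuple of successive quotients of a list with `n + 1` entries; other lists map to `0`. -/
def toTuple (n : ℕ) : LChain G →ₗ[ℤ] ((Fin n → G) →₀ ℤ) :=
  lext fun l => if h : l.length = n + 1 then
    Finsupp.single (fun j : Fin n => (l[(j : ℕ)])⁻¹ * l[(j : ℕ) + 1]) 1 else 0

theorem toTuple_ofFn (n : ℕ) (x : Fin (n + 1) → G) :
    toTuple n (cell (List.ofFn x)) =
      Finsupp.single (fun j : Fin n => (x j.castSucc)⁻¹ * x j.succ) 1 := by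
  rw [toTuple, lext_cell, dif_pos (by simp)]
  congr 1
  funext j
  simp only [List.getElem_ofFn]
  rfl

theorem toTuple_eq_zero {n : ℕ} {l : List G} (h : l.length ≠ n + 1) :
    toTuple n (cell l) = 0 := by
  rw [toTuple, lext_cell, dif_neg h]

theorem exists_ofFn {V : Type*} {l : List V} {n : ℕ} (h : l.length = n) :
    ∃ x : Fin n → V, l = List.ofFn x := by
  subst h
  exact ⟨l.get, (List.ofFn_get l).symm⟩

/-- The list of partial products of a tuple. -/
def ofTuple (n : ℕ) : ((Fin n → G) →₀ ℤ) →ₗ[ℤ] LChain G :=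
  Finsupp.linearCombination ℤ fun g => cell (List.ofFn (Fin.partialProd g))

theorem ofTuple_single (n : ℕ) (g : Fin n → G) :
    ofTuple n (Finsupp.single g 1) = cell (List.ofFn (Fin.partialProd g)) := by
  simp [ofTuple]

/-- The chain map induced by a homomorphism on tuples. -/
def mapTuple (k : G →* K) (n : ℕ) : ((Fin n → G) →₀ ℤ) →ₗ[ℤ] ((Fin n → K) →₀ ℤ) :=
  Finsupp.lmapDomain ℤ ℤ fun g j => k (g j)

theorem mapTuple_single (k : G →* K) (n : ℕ) (g : Fin n → G) :
    mapTuple k n (Finsupp.single g 1) = Finsupp.single (fun j => k (g j)) 1 := by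
  simp [mapTuple]

theorem toTuple_push (k : G →* K) (n : ℕ) (z : LChain G) :
    toTuple n (push k z) = mapTuple k n (toTuple n z) := by
  refine apply_ext (f := toTuple n ∘ₗ push k) (g := mapTuple k n ∘ₗ toTuple n)
    (fun l => ?_) z
  rw [LinearMap.comp_apply, LinearMap.comp_apply, push_cell]
  by_cases h : l.length = n + 1
  · obtain ⟨x, rfl⟩ := exists_ofFn h
    rw [List.map_ofFn, toTuple_ofFn, toTuple_ofFn, mapTuple_single]
    congr 1
    funext j
    simp
  · rw [toTuple_eq_zero h, toTuple_eq_zero (by simpa using h), map_zero]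

theorem toTuple_normalize (n : ℕ) (z : LChain G) : toTuple n (normalize z) = toTuple n z := by
  rw [← LinearMap.comp_apply]
  refine apply_ext (fun l => ?_) z
  rw [LinearMap.comp_apply, normalize_cell, push_cell]
  by_cases h : l.length = n + 1
  · obtain ⟨x, rfl⟩ := exists_ofFn h
    rw [List.map_ofFn, toTuple_ofFn, toTuple_ofFn]
    congr 1
    funext j
    simp
  · rw [toTuple_eq_zero h, toTuple_eq_zero (by simpa using h)]

theorem toTuple_congr (n : ℕ) {z z' : LChain G} (h : normalize z = normalize z') :
    toTuple n z = toTuple n z' := by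
  rw [← toTuple_normalize, h, toTuple_normalize]

/-- Partial products rebuild a list from its quotients, up to translation by its first vertex. -/
theorem normalize_ofTuple_toTuple {n C : ℕ} {z : LChain G} (h : Bdd (n + 1) C z) :
    normalize (ofTuple n (toTuple n z)) = normalize z := by
  rw [← LinearMap.comp_apply, ← LinearMap.comp_apply]
  refine h.eqOn fun l hl => ?_
  obtain ⟨x, rfl⟩ := exists_ofFn hl
  have hx := Fin.partialProd_left_inv x
  rw [LinearMap.comp_apply, LinearMap.comp_apply, toTuple_ofFn, ofTuple_single,
    ← normalize_translate (x 0), push_cell, List.map_ofFn]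
  conv_rhs => rw [← hx]
  rfl

theorem bd_ofFn {V : Type*} (n : ℕ) (x : Fin (n + 1) → V) :
    bd (cell (List.ofFn x)) =
      ∑ i : Fin (n + 1), (-1 : ℤ) ^ (i : ℕ) • cell (List.ofFn fun j => x (i.succAbove j)) := by
  induction n with
  | zero => simp
  | succ n ih =>
    rw [Fin.sum_univ_succ, List.ofFn_succ (f := x), bd_cons, ih, map_sum, sub_eq_add_neg,
      ← Finset.sum_neg_distrib]
    congr 1
    · simp
    · refine Finset.sum_congr rfl fun i _ => ?_
      rw [map_smul, pre_cell, List.ofFn_succ, Fin.val_succ, pow_succ, mul_neg_one, neg_smul]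
      simp

theorem toTuple_bd (n : ℕ) (z : LChain G) :
    toTuple n (bd z) = Bar.boundary G n (toTuple (n + 1) z) := by
  refine apply_ext (f := toTuple n ∘ₗ bd) (g := Bar.boundary G n ∘ₗ toTuple (n + 1))
    (fun l => ?_) z
  rw [LinearMap.comp_apply, LinearMap.comp_apply]
  by_cases h : l.length = n + 2
  · obtain ⟨x, rfl⟩ := exists_ofFn h
    rw [bd_ofFn, toTuple_ofFn, map_sum]
    simp only [Bar.boundary, LinearMap.sum_apply, LinearMap.smul_apply, map_smul, toTuple_ofFn,
      Finsupp.lmapDomain_apply, Finsupp.mapDomain_single]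
    refine Finset.sum_congr rfl fun i _ => ?_
    congr 2
    funext j
    simp only [Bar.face, Fin.succAbove, Fin.lt_def, Fin.val_castSucc, Fin.val_succ]
    split_ifs <;> first | (exfalso; omega) | simp [mul_assoc]
  · rw [toTuple_eq_zero h, map_zero]
    cases l with
    | nil => simp
    | cons x l =>
      exact (bdd_bd_cell x l).eqOn (F' := 0) fun l' hl' =>
        toTuple_eq_zero (by simp at h; omega)

theorem toTuple_ofTuple (n : ℕ) (g : Fin n → G) :
    toTuple n (cell (List.ofFn (Fin.partialProd g))) = Finsupp.single g 1 := by
  rw [toTuple_ofFn]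
  congr 1
  funext j
  exact Fin.partialProd_right_inv g j

end Comparison

/-! ### Diameters -/

open BasedChainComplex

theorem diameter_eq_sum {ι : Type u} (c : ι →₀ ℤ) {s : Finset ι} (h : c.support ⊆ s) :
    diameter c = ∑ i ∈ s, (c i).natAbs :=
  Finsupp.sum_of_support_subset _ h _ (by simp)

theorem diameter_add_le {ι : Type u} (c c' : ι →₀ ℤ) :
    diameter (c + c') ≤ diameter c + diameter c' := by
  classical
  rw [diameter_eq_sum (c + c') Finsupp.support_add, diameter_eq_sum c Finset.subset_union_left,
    diameter_eq_sum c' Finset.subset_union_right, ← Finset.sum_add_distrib]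
  exact Finset.sum_le_sum fun i _ => Int.natAbs_add_le _ _

theorem diameter_neg {ι : Type u} (c : ι →₀ ℤ) : diameter (-c) = diameter c := by
  rw [diameter_eq_sum (-c) (s := c.support) (by simp), diameter_eq_sum c subset_rfl]
  simp

theorem diameter_single {ι : Type u} (i : ι) : diameter (Finsupp.single i 1) = 1 := by
  simp [diameter]

theorem diameter_zero {ι : Type u} : diameter (0 : ι →₀ ℤ) = 0 := by
  simp [diameter]

theorem Bdd.diameter_toTuple_le {G : Type u} [Group G] {n C : ℕ} {z : LChain G}
    (h : Bdd (n + 1) C z) : diameter (toTuple n z) ≤ C := by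
  induction h with
  | cell h =>
    obtain ⟨x, rfl⟩ := exists_ofFn h
    rw [toTuple_ofFn, diameter_single]
  | zero K => simp [diameter_zero]
  | add _ _ h1 h2 => rw [map_add]; exact (diameter_add_le _ _).trans (add_le_add h1 h2)
  | neg _ h => rwa [map_neg, diameter_neg]
  | mono hK _ h => exact h.trans hK

/-! ### The trivial homomorphism -/

/-- The contraction of the chain map induced by the trivial homomorphism in positive degrees. -/
def trivialHomotopy (G K : Type u) [Group K] (n : ℕ) :
    ((Fin n → G) →₀ ℤ) →ₗ[ℤ] ((Fin (n + 1) → K) →₀ ℤ) :=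
  Finsupp.linearCombination ℤ fun _ =>
    if Odd n then Finsupp.single (fun _ => (1 : K)) (1 : ℤ) else 0

theorem trivialHomotopy_single {G K : Type u} [Group K] (n : ℕ) (g : Fin n → G) :
    trivialHomotopy G K n (Finsupp.single g 1) =
      if Odd n then Finsupp.single (fun _ => (1 : K)) (1 : ℤ) else 0 := by
  simp [trivialHomotopy]

/-- All faces of [1, …, 1] agree, so a boundary is governed by an alternating sum of signs, equal to
1 for an odd number of faces. Whichever of the two terms survives has an odd number of them. -/
theorem trivialHomotopy_comm (G K : Type u) [Group G] [Group K] (n : ℕ) (g : Fin (n + 1) → G) :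
    Bar.boundary K (n + 1) (trivialHomotopy G K (n + 1) (Finsupp.single g 1)) +
      trivialHomotopy G K n (Bar.boundary G n (Finsupp.single g 1)) =
      mapTuple (1 : G →* K) (n + 1) (Finsupp.single g 1) := by
  have hface : ∀ i : Fin (n + 3), Bar.face i (fun _ : Fin (n + 2) => (1 : K)) = fun _ => 1 := by
    intro i
    funext j
    simp [Bar.face]
  rw [mapTuple_single, trivialHomotopy_single]
  rcases Nat.even_or_odd n with hn | hn
  · rw [if_pos hn.add_one]
    simp only [Bar.boundary, LinearMap.sum_apply, LinearMap.smul_apply, map_sum, map_smul,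
      Finsupp.lmapDomain_apply, Finsupp.mapDomain_single, trivialHomotopy_single, hface,
      if_neg (Nat.not_odd_iff_even.2 hn), smul_zero, Finset.sum_const_zero, add_zero]
    have h3 : ¬ Even (n + 3) := Nat.not_even_iff_odd.2 (hn.add_odd (by decide))
    rw [← Finset.sum_smul, Fin.sum_neg_one_pow, if_neg h3, one_smul]
    rfl
  · rw [if_neg (Nat.not_odd_iff_even.2 hn.add_one), map_zero, zero_add]
    simp only [Bar.boundary, LinearMap.sum_apply, LinearMap.smul_apply, map_sum, map_smul,
      Finsupp.lmapDomain_apply, Finsupp.mapDomain_single, trivialHomotopy_single, if_pos hn]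
    have h2 : ¬ Even (n + 2) := Nat.not_even_iff_odd.2 (hn.add_even (by decide))
    rw [← Finset.sum_smul, Fin.sum_neg_one_pow, if_neg h2, one_smul]
    rfl

/-! ### From null homotopies of lists to partial homotopies -/

section Partial

variable {G K : Type u} [Group G] [Group K]

/-- The partial-product section commutes with the boundary only modulo translation, since the face
omitting the first vertex no longer starts at 1; `Descends` absorbs the difference. -/
theorem IsNullHomotopy.comm_tuple {k : G →* K} {n : ℕ} {γ : ℕ → ℕ}
    {Θ : LChain G →ₗ[ℤ] LChain K} (h : IsNullHomotopy k n γ Θ) (i : ℕ) (hi : i + 1 ≤ n)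
    (g : Fin (i + 1) → G) :
    Bar.boundary K (i + 1) (toTuple (i + 2) (Θ (ofTuple (i + 1) (Finsupp.single g 1)))) +
      toTuple (i + 1) (Θ (ofTuple i (Bar.boundary G i (Finsupp.single g 1)))) =
      mapTuple k (i + 1) (Finsupp.single g 1) := by
  obtain ⟨x, l, hl⟩ := List.exists_cons_of_length_eq_add_one
    (show (List.ofFn (Fin.partialProd g)).length = (i + 1) + 1 by simp)
  have hlen : l.length = i + 1 := by
    have := congrArg List.length hl
    simp at this
    omega
  have hb : Bdd (i + 1) (i + 1 + 1) (bd (cell (List.ofFn (Fin.partialProd g)))) := by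
    have := bdd_bd_cell x l
    rwa [← hl, hlen] at this
  rw [← toTuple_ofTuple (i + 1) g, ← toTuple_bd, ← toTuple_bd,
    toTuple_congr (i + 1) (h.descends.congr (normalize_ofTuple_toTuple hb)),
    toTuple_ofTuple, ofTuple_single, ← map_add, toTuple_congr _ (h.comm _ (by simp; omega)),
    toTuple_push, trunc_cell, if_pos (by simp), toTuple_ofTuple]

/-- The operator on tuples given by a null homotopy of lists. -/
def tupleHomotopy (Θ : LChain G →ₗ[ℤ] LChain K) (i : ℕ) :
    ((Fin i → G) →₀ ℤ) →ₗ[ℤ] ((Fin (i + 1) → K) →₀ ℤ) :=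
  toTuple (i + 1) ∘ₗ Θ ∘ₗ ofTuple i - trivialHomotopy G K i

theorem tupleHomotopy_single (Θ : LChain G →ₗ[ℤ] LChain K) (i : ℕ) (g : Fin i → G) :
    tupleHomotopy Θ i (Finsupp.single g 1) =
      toTuple (i + 1) (Θ (cell (List.ofFn (Fin.partialProd g)))) -
        if Odd i then Finsupp.single (fun _ => (1 : K)) (1 : ℤ) else 0 := by
  rw [tupleHomotopy, LinearMap.sub_apply, LinearMap.comp_apply, LinearMap.comp_apply,
    ofTuple_single, trivialHomotopy_single]

theorem IsNullHomotopy.tuple_comm_zero {k : G →* K} {n : ℕ} {γ : ℕ → ℕ}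
    {Θ : LChain G →ₗ[ℤ] LChain K} (h : IsNullHomotopy k n γ Θ) (hγ : γ 0 = 0) :
    Bar.boundary K 0 ∘ₗ tupleHomotopy Θ 0 = mapTuple k 0 - mapTuple 1 0 := by
  refine Finsupp.lhom_ext' fun g => LinearMap.ext_ring ?_
  have h0 := h.bdd (List.ofFn (Fin.partialProd g))
  rw [List.length_ofFn, Nat.add_sub_cancel, hγ] at h0
  simp only [LinearMap.comp_apply, LinearMap.sub_apply, Finsupp.lsingle_apply]
  rw [tupleHomotopy_single, h0.eq_zero, if_neg (by decide), map_zero, sub_zero, map_zero,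
    mapTuple_single, mapTuple_single, eq_comm, sub_eq_zero]
  congr 1
  exact Subsingleton.elim _ _

theorem IsNullHomotopy.tuple_comm_succ {k : G →* K} {n : ℕ} {γ : ℕ → ℕ}
    {Θ : LChain G →ₗ[ℤ] LChain K} (h : IsNullHomotopy k n γ Θ) (i : ℕ) (hi : i + 1 ≤ n) :
    Bar.boundary K (i + 1) ∘ₗ tupleHomotopy Θ (i + 1) + tupleHomotopy Θ i ∘ₗ Bar.boundary G i =
      mapTuple k (i + 1) - mapTuple 1 (i + 1) := by
  refine Finsupp.lhom_ext' fun g => LinearMap.ext_ring ?_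
  have h1 := h.comm_tuple i hi g
  have h2 := trivialHomotopy_comm G K i g
  simp only [LinearMap.comp_apply, LinearMap.sub_apply, LinearMap.add_apply,
    Finsupp.lsingle_apply, tupleHomotopy, map_sub]
  rw [← h1, ← h2]
  abel

/-- The partial homotopy in the bar construction given by a null homotopy of lists. -/
def IsNullHomotopy.partialHomotopy {k : G →* K} {n : ℕ} {γ : ℕ → ℕ}
    {Θ : LChain G →ₗ[ℤ] LChain K} (h : IsNullHomotopy k n γ Θ) (hγ : γ 0 = 0) :
    PartialHomotopy (Bar.map k) (Bar.map (1 : G →* K)) n where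
  hom i _ := tupleHomotopy Θ i
  comm_zero := h.tuple_comm_zero hγ
  comm_succ := h.tuple_comm_succ

theorem IsNullHomotopy.controlledBy {k : G →* K} {n : ℕ} {γ : ℕ → ℕ}
    {Θ : LChain G →ₗ[ℤ] LChain K} (h : IsNullHomotopy k n γ Θ) (hγ : γ 0 = 0)
    (hpos : ∀ m, 1 ≤ m → 1 ≤ γ m) (hmono : Monotone γ) :
    (h.partialHomotopy hγ).ControlledBy γ := by
  suffices key : ∀ (i : ℕ) (g : Fin i → G),
      diameter (tupleHomotopy Θ i (Finsupp.single g 1)) ≤ γ i from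
    fun m hm => iSup_le fun i => iSup_le fun hi => iSup_le fun g =>
      Nat.cast_le.2 ((key i g).trans (hmono hi))
  intro i g
  have h1 := h.bdd (List.ofFn (Fin.partialProd g))
  rw [List.length_ofFn, Nat.add_sub_cancel] at h1
  have h2 := h1.diameter_toTuple_le
  rw [tupleHomotopy_single]
  split_ifs with ho
  · rw [sub_eq_add_neg]
    refine (diameter_add_le _ _).trans ?_
    rw [diameter_neg, diameter_single]
    -- The extra degenerate simplex in odd degree uses the unit reserved by the bound `γ i - 1`.
    have := hpos i ho.pos
    omega
  · rw [sub_zero]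
    exact h2.trans (Nat.sub_le _ _)

end Partial

/-! ### Mitosis -/

section Mitosis

variable (G : Type u) [Group G]

/-- The class of the stable letter `u`. -/
def letterU : Mitosis G := QuotientGroup.mk (Monoid.Coprod.inr (FreeGroup.of false))

/-- The class of the stable letter `t`. -/
def letterT : Mitosis G := QuotientGroup.mk (Monoid.Coprod.inr (FreeGroup.of true))

theorem mitosis_conj_t (a : G) :
    letterT G * Mitosis.incl G a * (letterT G)⁻¹ =
      Mitosis.incl G a * (letterU G * Mitosis.incl G a * (letterU G)⁻¹) := by
  rw [← mul_inv_eq_one]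
  exact (QuotientGroup.eq_one_iff _).2
    (Subgroup.subset_normalClosure (Or.inl ⟨a, rfl⟩))

theorem mitosis_conj_u_comm (a b : G) :
    Commute (letterU G * Mitosis.incl G a * (letterU G)⁻¹) (Mitosis.incl G b) := by
  rw [commute_iff_eq, ← mul_inv_eq_iff_eq_mul, ← mul_inv_eq_one]
  exact (QuotientGroup.eq_one_iff _).2
    (Subgroup.subset_normalClosure (Or.inr ⟨a, b, rfl⟩))

/-- The embedding `x ↦ u⁻¹ x u`. -/
def conjIncl : G →* Mitosis G := (MulAut.conj (letterU G)⁻¹).toMonoidHom.comp (Mitosis.incl G)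

theorem conjIncl_apply (x : G) :
    conjIncl G x = (letterU G)⁻¹ * Mitosis.incl G x * letterU G := by
  simp [conjIncl]

theorem commute_incl_conjIncl (x y : G) : Commute (Mitosis.incl G x) (conjIncl G y) := by
  have h := mitosis_conj_u_comm G x y
  rw [conjIncl_apply, commute_iff_eq]
  rw [commute_iff_eq] at h
  have := congrArg (fun z => (letterU G)⁻¹ * z * letterU G) h
  simpa [mul_assoc] using this

/-- This is the relation for t conjugated by u⁻¹. In the original form the cancellation would leave
a null homotopy of a ↦ a^u; after conjugation it leaves one of the inclusion itself, with no further
homotopy to pay for. -/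
theorem conj_conjIncl (x : G) :
    ((letterU G)⁻¹ * letterT G * letterU G) * conjIncl G x *
      ((letterU G)⁻¹ * letterT G * letterU G)⁻¹ = Mitosis.incl G x * conjIncl G x := by
  have h := mitosis_conj_t G x
  rw [← (mitosis_conj_u_comm G x x).eq] at h
  have := congrArg (fun z => (letterU G)⁻¹ * z * letterU G) h
  rw [conjIncl_apply]
  simpa [mul_assoc] using this

end Mitosis

/-! ### Induction over iterated mitoses and the control function -/

theorem exists_isNullHomotopy {γ : ℕ → ℕ} (hγ : γ 0 = 0)
    (hγs : ∀ m, 1 ≤ m → γ m = 2 ^ m * (m + 1) +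
      ∑ i ∈ Finset.Icc 1 (m - 1), γ i * (m + 1).choose (m - i)) (G : GrpCat.{u}) (n : ℕ) :
    ∃ Θ, IsNullHomotopy (Mitosis.embedding G n) n γ Θ := by
  induction n with
  | zero =>
    -- For n = 0 only lists with at most one vertex matter, and truncation kills them.
    refine ⟨0, fun l => .zero _, fun _ _ => rfl, fun l hl => ?_⟩
    rw [trunc_cell, if_neg (by omega)]
    simp
  | succ n ih =>
    obtain ⟨Θ, hΘ⟩ := ih
    exact ⟨_, hΘ.step (commute_incl_conjIncl _) (conj_conjIncl _) hγ hγs⟩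

/-- The universal control function. -/
def controlFun : ℕ → ℕ
  | 0 => 0
  | m + 1 => 2 ^ (m + 1) * (m + 2) +
      ∑ k : Fin m, controlFun (k + 1) * (m + 2).choose (m - k)

theorem controlFun_of_pos (m : ℕ) (hm : 1 ≤ m) : controlFun m = 2 ^ m * (m + 1) +
    ∑ i ∈ Finset.Icc 1 (m - 1), controlFun i * (m + 1).choose (m - i) := by
  obtain ⟨m, rfl⟩ := Nat.exists_eq_add_of_le' hm
  rw [controlFun, Nat.add_sub_cancel, Fin.sum_univ_eq_sum_range
    (fun k => controlFun (k + 1) * (m + 2).choose (m - k)), Finset.range_eq_Ico,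
    ← Finset.Ico_add_one_right_eq_Icc, Finset.sum_Ico_eq_sum_range, Finset.sum_Ico_eq_sum_range]
  congr 1
  refine Finset.sum_congr (by simp) fun i _ => ?_
  rw [zero_add, add_comm 1 i, Nat.add_sub_add_right]

theorem controlFun_mono : Monotone controlFun := by
  refine monotone_nat_of_le_succ fun m => ?_
  rcases Nat.eq_zero_or_pos m with rfl | hm
  · rw [controlFun]
    exact Nat.zero_le _
  · rw [controlFun_of_pos (m + 1) (by omega), Nat.add_sub_cancel]
    refine le_trans ?_ (Nat.le_add_left _ _)
    -- The value at m occurs in the recursion at m + 1 as the summand i = m, with a positive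
    -- binomial coefficient.
    refine le_trans ?_ (Finset.single_le_sum (f := fun i => controlFun i *
      (m + 1 + 1).choose (m + 1 - i)) (fun _ _ => Nat.zero_le _) (Finset.mem_Icc.2 ⟨hm, le_rfl⟩))
    exact Nat.le_mul_of_pos_right _ (Nat.choose_pos (by omega))

end ListChain
end

open ListChain in
theorem theorem4p1 :
    ∃ γ : ℕ → ℕ,
      (γ 0 = 0 ∧ γ 1 = 4 ∧ γ 2 = 24 ∧ γ 3 = 152 ∧ γ 4 = 1120 ∧ γ 5 = 9732 ∧
        γ 6 = 98336 ∧ γ 7 = 1135024) ∧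
      (∀ m : ℕ, 1 ≤ m →
        γ m = 2 ^ m * (m + 1) +
          ∑ k ∈ Finset.Icc 1 (m - 1), γ k * Nat.choose (m + 1) (m - k)) ∧
      ∀ n : ℕ,
        ∃ Ψ : ∀ G : GrpCat.{u},
          BasedChainComplex.PartialHomotopy
            (Bar.map (Mitosis.embedding G n))
            (Bar.map (1 : G →* Mitosis.iter G n)) n,
          BasedChainComplex.UniformlyControlledBy Ψ γ := by
  have h0 : controlFun 0 = 0 := by rw [controlFun]
  have h1 : controlFun 1 = 4 := by rw [controlFun]; simp
  have h2 : controlFun 2 = 24 := by rw [controlFun]; simp [h1]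
  have h3 : controlFun 3 = 152 := by
    rw [controlFun]; simp [Fin.sum_univ_succ, h1, h2, Nat.choose]
  have h4 : controlFun 4 = 1120 := by
    rw [controlFun]; simp [Fin.sum_univ_succ, h1, h2, h3, Nat.choose]
  have h5 : controlFun 5 = 9732 := by
    rw [controlFun]; simp [Fin.sum_univ_succ, h1, h2, h3, h4, Nat.choose]
  have h6 : controlFun 6 = 98336 := by
    rw [controlFun]; simp [Fin.sum_univ_succ, h1, h2, h3, h4, h5, Nat.choose]
  have h7 : controlFun 7 = 1135024 := by
    rw [controlFun]; simp [Fin.sum_univ_succ, h1, h2, h3, h4, h5, h6, Nat.choose]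
  refine ⟨controlFun, ⟨h0, h1, h2, h3, h4, h5, h6, h7⟩, controlFun_of_pos, fun n => ?_⟩
  choose Θ hΘ using fun G : GrpCat.{u} => exists_isNullHomotopy h0 controlFun_of_pos G n
  refine ⟨fun G => (hΘ G).partialHomotopy h0, fun G => (hΘ G).controlledBy h0 (fun m hm => ?_)
    controlFun_mono⟩
  rw [controlFun_of_pos m hm]
  exact Nat.le_add_right_of_le (Nat.mul_pos (by positivity) (by omega))
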